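/- Let $K$ be a field of characteristic different from $2$. Let $M=\{m\in\mathbb{Z}^5:\sum m_i=0\}$ be the $A_4$ root lattice and let $\widetilde P$ be the smooth toric fourfold over $K$ whose fan consists of the $120$ Weyl chambers $\{\alpha\in\mathbb{R}^5:\sum\alpha_i=0,\ \alpha_{\varsigma(1)}\ge\alpha_{\varsigma(2)}\ge\dots\ge\alpha_{\varsigma(5)}\}$ ($\varsigma\in S_5$) and their faces. Its open torus is identified with $T=\mathbb{P}^4\setminus\{X_1X_2X_3X_4X_5=0\}$, the character $e_i-e_j\in M$ being $X_i/X_j$. For $\boldsymbol a=(a_1:\dots:a_6)\in\mathbb{P}^5$ let $X_{\boldsymbol a}\subset\widetilde P$ be the closure of the hypersurface $$(X_1+\dots+X_5)\left(\frac{a_1}{X_1}+\dots+\frac{a_5}{X_5}\right)=a_6$$ of $T$, and for $\boldsymbol b=(b_1:\dots:b_5)\in T$ put $$\phi(\boldsymbol b)=\bigl(b_1^2:\dots:b_5^2:(b_1+\dots+b_5)^2\bigr).$$ Let $\boldsymbol b\in T(K)$ with $b_1+\dots+b_5\neq0$. Then the number of nodes ($A_1$ singularities at $K$-points) of $X_{\phi(\boldsymbol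 b)}$ is exactly $$30+\#\Bigl\{J\subseteq\{1,2,3,4,5\}:\ \sum_{i\in J}b_i=0\Bigr\}$$ (the empty set $J=\emptyset$ is counted). Exactly $30$ of these nodes lie on the toric boundary $\widetilde P\setminus T$, and the nodes in $T$ correspond to sign changes of $\boldsymbol b$: the map sending $J$ to the point obtained from $(b_1:\dots:b_5)$ by changing the sign of $b_i$ for all $i\in J$ is a bijection from $\{J\subseteq\{1,\dots,5\}:\sum_{i\in J}b_i=0\}$ onto the set of nodes of $X_{\phi(\boldsymbol b)}$ in $T$. -/

import Mathlib

noncomputable section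

namespace A4Toric

/-- The root lattice `M` of type `A₄`: integer vectors of length five with sum zero.
It is the character lattice of the torus. -/
def rootLattice : AddSubgroup (Fin 5 → ℤ) where
  carrier := {m | ∑ i, m i = 0}
  zero_mem' := by simp
  add_mem' := by
    intro a b ha hb
    simp only [Set.mem_ofPred_eq, Pi.add_apply, Finset.sum_add_distrib] at *
    omega
  neg_mem' := by
    intro a ha
    simp only [Set.mem_ofPred_eq, Pi.neg_apply, Finset.sum_neg_distrib] at *
    omega

/-- The vector `e_i - e_j` of the root lattice; as a character of the torus it is `X_i / X_j`. -/
def root (i j : Fin 5) : rootLattice :=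
  ⟨Pi.single i 1 - Pi.single j 1, by
    change ∑ k, (Pi.single i (1 : ℤ) - Pi.single j 1 : Fin 5 → ℤ) k = 0
    simp [Finset.sum_sub_distrib]⟩

/-- The Weyl chamber `α_{ς 0} ≥ α_{ς 1} ≥ ⋯ ≥ α_{ς 4}` in `{α ∈ ℝ⁵ | ∑ α_i = 0}`.
The 120 chambers are the maximal cones of the fan. -/
def chamber (ς : Equiv.Perm (Fin 5)) : Set (Fin 5 → ℝ) :=
  {α | ∑ i, α i = 0 ∧ Antitone (α ∘ ς)}

/-- The monoid `C^∨ ∩ M` of lattice points of the dual cone of `C`. -/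
def dualMonoid (C : Set (Fin 5 → ℝ)) : AddSubmonoid rootLattice where
  carrier := {m | ∀ α ∈ C, 0 ≤ ∑ i, α i * ((m.1 i : ℤ) : ℝ)}
  zero_mem' := by
    intro α _
    simp
  add_mem' := by
    intro a b ha hb α hα
    have h1 := ha α hα
    have h2 := hb α hα
    simp only [AddSubgroup.coe_add, Pi.add_apply, Int.cast_add, mul_add, Finset.sum_add_distrib]
    exact add_nonneg h1 h2

/-- The basis vectors `e_{ς l} - e_{ς (l+1)}`, `l = 0, …, 3`, of the dual of the chamber of `ς`. -/
def simpleRoot (ς : Equiv.Perm (Fin 5)) (l : Fin 4) : rootLattice :=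
  root (ς l.castSucc) (ς l.succ)

theorem simpleRoot_mem (ς : Equiv.Perm (Fin 5)) (l : Fin 4) {C : Set (Fin 5 → ℝ)}
    (hC : C ⊆ chamber ς) : simpleRoot ς l ∈ dualMonoid C := by
  intro α hα
  have h : α (ς l.succ) ≤ α (ς l.castSucc) := (hC hα).2 (Fin.castSucc_lt_succ).le
  have e : ∑ i, α i * (((simpleRoot ς l).1 i : ℤ) : ℝ) = α (ς l.castSucc) - α (ς l.succ) := by
    simp [simpleRoot, root, mul_sub, Finset.sum_sub_distrib, Pi.single_apply]
  rw [e]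
  linarith

/-- The gluing of the affine charts. The chart of `ς` is the affine space with ring of functions
`K[(chamber ς)^∨ ∩ M]`, and its coordinates are the characters `simpleRoot ς l`. The charts of
`ς` and `τ` are glued along the affine toric variety of the cone `chamber ς ∩ chamber τ`, whose
`K`-points are the monoid homomorphisms from the dual monoid of that cone to `(K, ·)`: a point
`p` of the first chart is identified with a point `q` of the second if both are the image of
the same `K`-point `χ`. -/
def Glue (K : Type*) [Field K] (P Q : Equiv.Perm (Fin 5) × (Fin 4 → K)) : Prop :=
  ∃ χ : Multiplicative (dualMonoid (chamber P.1 ∩ chamber Q.1)) →* K,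
    (∀ l, χ (Multiplicative.ofAdd
      ⟨simpleRoot P.1 l, simpleRoot_mem P.1 l Set.inter_subset_left⟩) = P.2 l) ∧
    (∀ l, χ (Multiplicative.ofAdd
      ⟨simpleRoot Q.1 l, simpleRoot_mem Q.1 l Set.inter_subset_right⟩) = Q.2 l)

/-- The set of `K`-points of the smooth toric fourfold of the fan of Weyl chambers of type `A₄`. -/
def ToricVariety (K : Type*) [Field K] : Type _ := Quot (Glue K)

/-- The point with coordinates `p` in the affine chart of `ς`. -/
def chartPoint {K : Type*} [Field K] (ς : Equiv.Perm (Fin 5)) (p : Fin 4 → K) : ToricVariety K :=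
  Quot.mk _ (ς, p)

/-- The point `(c_0 : ⋯ : c_4)` of the torus (meant for nonzero `c_i`), as a point of the
toric variety. -/
def torusPoint {K : Type*} [Field K] (c : Fin 5 → K) : ToricVariety K :=
  chartPoint 1 fun l => c l.castSucc / c l.succ

/-- The open torus `T = ℙ⁴ ∖ {X_0 ⋯ X_4 = 0}`; the toric boundary is its complement. -/
def torus (K : Type*) [Field K] : Set (ToricVariety K) :=
  {P | ∃ c : Fin 5 → K, (∀ i, c i ≠ 0) ∧ P = torusPoint c}

/-- The Laurent polynomial `(∑ X_i) (∑ a_j / X_j) - a_5`, expanded in characters `X_i / X_j`. -/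
def equation {K : Type*} [Field K] (a : Fin 6 → K) : AddMonoidAlgebra K rootLattice :=
  ∑ i : Fin 5, ∑ j : Fin 5, AddMonoidAlgebra.single (root i j) (a j.castSucc)
    - AddMonoidAlgebra.single 0 (a (Fin.last 5))

/-- Restriction of regular functions from the chart of `ς` to the torus:
the coordinate `x_l` goes to the character `X_{ς l} / X_{ς (l+1)}`. -/
def restrictToTorus (K : Type*) [Field K] (ς : Equiv.Perm (Fin 5)) :
    MvPolynomial (Fin 4) K →ₐ[K] AddMonoidAlgebra K rootLattice :=
  MvPolynomial.aeval fun l => AddMonoidAlgebra.single (simpleRoot ς l) 1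

/-- The ideal, in the chart of `ς`, of `X_a`, the closure in the toric variety of the hypersurface
`(∑ X_i) (∑ a_j / X_j) = a_5` of the torus: all polynomials whose restriction to the torus
lies in the ideal of that hypersurface. -/
def chartIdeal {K : Type*} [Field K] (a : Fin 6 → K) (ς : Equiv.Perm (Fin 5)) :
    Ideal (MvPolynomial (Fin 4) K) :=
  (Ideal.span {equation a}).comap (restrictToTorus K ς)

/-- `p` is a node (`A₁` singularity, ordinary double point) of the hypersurface with ideal `I` in
affine `n`-space over a field of characteristic other than two: a generator of `I` vanishes at `p`
together with its first derivatives, and its Hessian matrix at `p` is nondegenerate. -/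
def IsAffineNode {K : Type*} [Field K] {n : ℕ} (I : Ideal (MvPolynomial (Fin n) K))
    (p : Fin n → K) : Prop :=
  ∃ F : MvPolynomial (Fin n) K, I = Ideal.span {F} ∧
    MvPolynomial.eval p F = 0 ∧
    (∀ i, MvPolynomial.eval p (MvPolynomial.pderiv i F) = 0) ∧
    (Matrix.of fun i j =>
      MvPolynomial.eval p (MvPolynomial.pderiv i (MvPolynomial.pderiv j F))).det ≠ 0

/-- The set of nodes of `X_a`, the closure in the toric variety of the hypersurface
`(∑ X_i) (∑ a_j / X_j) = a_5` of the torus. -/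
def nodes {K : Type*} [Field K] (a : Fin 6 → K) : Set (ToricVariety K) :=
  {P | ∃ (ς : Equiv.Perm (Fin 5)) (p : Fin 4 → K),
    P = chartPoint ς p ∧ IsAffineNode (chartIdeal a ς) p}

/-- `φ(b) = (b_0² : ⋯ : b_4² : (b_0 + ⋯ + b_4)²)`. -/
def phi {K : Type*} [Field K] (b : Fin 5 → K) : Fin 6 → K :=
  Fin.snoc (fun i => b i ^ 2) ((∑ i, b i) ^ 2)

/-- Change the signs of the coordinates `b_i`, `i ∈ J`. -/
def signChange {K : Type*} [Field K] (b : Fin 5 → K) (J : Finset (Fin 5)) : Fin 5 → K :=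
  fun i => if i ∈ J then -b i else b i

end A4Toric

end

/-!
In the chart of `ς` the hypersurface is `(∑ X_k) (∑ a_k / X_k) = s` with denominators cleared, where
`X_0, …, X_4` are the coordinates in the order of `ς` and `x_l = X_l / X_{l+1}`. Write `A` and `B`
for the two factors, cleared of denominators, and `A_k`, `B_k` for their terms. The derivations
`x_l ∂/∂x_l` replace `A` by a partial sum from the front and `B` by a partial sum from the back, so
that differences of consecutive derivatives show that `A_k * B = A * B_k` at a singular point.

On the torus this says `X_k² = (∑ X_i)² a_k / s`, which for `a = φ(b)` leaves the sign changes of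
`b` that preserve `∑ b_i`. The Hessian there is a multiple of the matrix
`S_{min(l, m)} (σ - S_{max(l, m)})` of partial sums `S_l` of the coordinates with total `σ`, the
covariance matrix of a Brownian bridge, whose determinant is a monomial in `σ` and the coordinates.

On the boundary it forces `A = B = 0`, and then two of the coordinates `x_l` vanish; in dimension
four these are `x_1` and `x_2`, and the other two coordinates are determined. This point of the
chart only depends on the ordered partition `{ς 0, ς 1}, {ς 2}, {ς 3, ς 4}`, which it determines
through the zeros of the functions `X_i / X_j`. There are `5! / (2! 2!) = 30` such partitions.
-/

noncomputable section

namespace A4Toric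

theorem eq_zero_of_sum_Iic_eq_zero {ι M : Type*} [LinearOrder ι] [LocallyFiniteOrderBot ι]
    [WellFoundedLT ι] [AddCommMonoid M] {w : ι → M} (h : ∀ l, ∑ k ∈ Finset.Iic l, w k = 0) (l : ι) :
    w l = 0 := by
  induction l using WellFoundedLT.induction with
  | ind l ih =>
    rw [← h l, ← Finset.Iio_insert l, Finset.sum_insert Finset.notMem_Iio_self,
      Finset.sum_eq_zero fun k hk => ih k (Finset.mem_Iio.1 hk), add_zero]

theorem eq_of_lt_iff_lt {α : Type*} {n : ℕ} {f g : α → Fin n} (hf : Function.Surjective f)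
    (hg : Function.Surjective g) (h : ∀ i j, f i < f j ↔ g i < g j) : f = g := by
  choose r hr using hf
  have hgr (i : α) : g (r (f i)) = g i :=
    eq_of_forall_lt_iff fun c => by
      obtain ⟨j, rfl⟩ := hg c
      rw [← h, ← h, hr]
  have hmono : StrictMono (g ∘ r) := fun k l hkl => (h _ _).1 (by simpa only [hr] using hkl)
  have hsurj : Function.Surjective (g ∘ r) := fun c => by
    obtain ⟨j, rfl⟩ := hg c
    exact ⟨f j, hgr j⟩
  have hid : g ∘ r = id :=
    (hmono.range_inj strictMono_id).1 (by rw [hsurj.range_eq, Set.range_id])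
  funext i
  rw [← hgr i]
  exact (congrFun hid (f i)).symm

theorem encard_range_eq_of_eq_iff_eq {α β γ : Type*} {f : α → β} {g : α → γ}
    (h : ∀ x y, f x = f y ↔ g x = g y) : (Set.range f).encard = (Set.range g).encard :=
  Set.encard_congr <| (Setoid.quotientKerEquivRange f).symm.trans <|
    (Quotient.congrRight h).trans (Setoid.quotientKerEquivRange g)

section SegmentProd

variable {n : ℕ} {M N : Type*} [CommMonoid M] [CommMonoid N]

/-- The product `x_k x_{k+1} ⋯ x_{l-1}`. The indices `k ≤ l` range over the `n + 1` gaps between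
the `n` factors; the product is empty if `l ≤ k`. -/
def segmentProd (x : Fin n → M) (k l : Fin (n + 1)) : M :=
  ∏ m with k ≤ m.castSucc ∧ m.castSucc < l, x m

theorem segmentProd_self (x : Fin n → M) (k : Fin (n + 1)) : segmentProd x k k = 1 :=
  Finset.prod_eq_one fun m hm => by
    obtain ⟨h, h'⟩ := (Finset.mem_filter.1 hm).2
    exact absurd h' h.not_gt

theorem segmentProd_mul_segmentProd (x : Fin n → M) {k l m : Fin (n + 1)} (hkl : k ≤ l)
    (hlm : l ≤ m) : segmentProd x k l * segmentProd x l m = segmentProd x k m := by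
  rw [segmentProd, segmentProd, segmentProd, ← Finset.prod_union]
  · congr 1
    ext i
    simp only [Finset.mem_union, Finset.mem_filter, Finset.mem_univ, true_and]
    grind
  · rw [Finset.disjoint_filter]
    exact fun i _ hi hi' => hi'.1.not_gt hi.2

theorem segmentProd_castSucc_succ (x : Fin n → M) (l : Fin n) :
    segmentProd x l.castSucc l.succ = x l := by
  have : ({m | l.castSucc ≤ m.castSucc ∧ m.castSucc < l.succ} : Finset (Fin n)) = {l} := by
    ext m
    simp [Fin.castSucc_lt_succ_iff, le_antisymm_iff, and_comm]
  rw [segmentProd, this, Finset.prod_singleton]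

theorem segmentProd_zero_last (x : Fin n → M) : segmentProd x 0 (Fin.last n) = ∏ m, x m := by
  simp [segmentProd, Fin.castSucc_lt_last]

theorem map_segmentProd {F : Type*} [FunLike F M N] [MonoidHomClass F M N] (f : F)
    (x : Fin n → M) (k l : Fin (n + 1)) :
    f (segmentProd x k l) = segmentProd (fun m => f (x m)) k l :=
  map_prod f _ _

theorem segmentProd_of_cocycle {f : Fin (n + 1) → Fin (n + 1) → M} (hone : ∀ k, f k k = 1)
    (hmul : ∀ k l m, f k l * f l m = f k m) {k l : Fin (n + 1)} (h : k ≤ l) :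
    segmentProd (fun m => f m.castSucc m.succ) k l = f k l := by
  induction l using Fin.induction with
  | zero => rw [Fin.le_zero_iff.1 h, segmentProd_self, hone]
  | succ l ih =>
    rcases h.lt_or_eq with h | rfl
    · have hk : k ≤ l.castSucc := Fin.le_castSucc_iff.2 h
      rw [← segmentProd_mul_segmentProd _ hk l.castSucc_le_succ, ih hk,
        segmentProd_castSucc_succ, hmul]
    · rw [segmentProd_self, hone]

end SegmentProd

section TorusCoords

variable {n : ℕ} {K : Type*} [Field K]

/-- The successive ratios `c_l / c_{l+1}`, which are the coordinates of the point
`(c_0 : ⋯ : c_n)` of the torus in a chart of the toric variety. -/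
def torusCoords (c : Fin (n + 1) → K) : Fin n → K :=
  fun l => c l.castSucc / c l.succ

theorem torusCoords_smul {t : K} (ht : t ≠ 0) (c : Fin (n + 1) → K) :
    torusCoords (t • c) = torusCoords c :=
  funext fun _ => mul_div_mul_left _ _ ht

theorem segmentProd_torusCoords {c : Fin (n + 1) → K} (hc : ∀ i, c i ≠ 0) {k l : Fin (n + 1)}
    (h : k ≤ l) : segmentProd (torusCoords c) k l = c k / c l :=
  segmentProd_of_cocycle (f := fun k l => c k / c l) (fun k => div_self (hc k))
    (fun _ l _ => div_mul_div_cancel₀ (hc l)) h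

theorem segmentProd_ne_zero {p : Fin n → K} (hp : ∀ l, p l ≠ 0) (k l : Fin (n + 1)) :
    segmentProd p k l ≠ 0 :=
  Finset.prod_ne_zero_iff.2 fun m _ => hp m

theorem torusCoords_segmentProd {p : Fin n → K} (hp : ∀ l, p l ≠ 0) :
    torusCoords (fun k => segmentProd p k (Fin.last n)) = p := by
  funext l
  rw [torusCoords, div_eq_iff (segmentProd_ne_zero hp _ _), ← segmentProd_castSucc_succ p l,
    segmentProd_mul_segmentProd p l.castSucc_le_succ (Fin.le_last _)]

end TorusCoords

section Lattice

theorem root_val (i j : Fin 5) : (root i j).1 = Pi.single i 1 - Pi.single j 1 := rfl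

theorem root_self (i : Fin 5) : root i i = 0 := Subtype.ext (by simp [root_val])

theorem root_add_root (i j k : Fin 5) : root i j + root j k = root i k :=
  Subtype.ext (by simp [root_val])

theorem root_mem_dualMonoid {ς : Equiv.Perm (Fin 5)} {C : Set (Fin 5 → ℝ)} (hC : C ⊆ chamber ς)
    {i j : Fin 5} (hij : ς.symm i ≤ ς.symm j) : root i j ∈ dualMonoid C := by
  intro α hα
  have pairing : ∑ k, α k * (((root i j).1 k : ℤ) : ℝ) = α i - α j := by
    simp [root_val, mul_sub, Finset.sum_sub_distrib, Pi.single_apply]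
  have anti := (hC hα).2 hij
  simp only [Function.comp_apply, Equiv.apply_symm_apply] at anti
  rw [pairing]
  exact sub_nonneg.2 anti

theorem segmentProd_simpleRoot (ς : Equiv.Perm (Fin 5)) {k l : Fin 5} (h : k ≤ l) :
    segmentProd (fun m => Multiplicative.ofAdd (simpleRoot ς m)) k l =
      Multiplicative.ofAdd (root (ς k) (ς l)) :=
  segmentProd_of_cocycle (f := fun k l => Multiplicative.ofAdd (root (ς k) (ς l)))
    (fun k => by rw [root_self, ofAdd_zero])
    (fun k l m => by rw [← ofAdd_add, root_add_root]) h

variable {K : Type*} [Field K]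

/-- The value of the character `m` at the point `c` of the torus. -/
def character (c : Fin 5 → K) (m : rootLattice) : K := ∏ i, c i ^ m.1 i

theorem character_zero (c : Fin 5 → K) : character c 0 = 1 := by
  simp [character]

theorem character_add {c : Fin 5 → K} (hc : ∀ i, c i ≠ 0) (m n : rootLattice) :
    character c (m + n) = character c m * character c n := by
  simp [character, zpow_add₀ (hc _), Finset.prod_mul_distrib]

theorem character_root {c : Fin 5 → K} (hc : ∀ i, c i ≠ 0) (i j : Fin 5) :
    character c (root i j) = c i / c j := by
  have prod_single (i : Fin 5) : ∏ k, c k ^ (Pi.single i (1 : ℤ) : Fin 5 → ℤ) k = c i := by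
    rw [Finset.prod_eq_single i] <;> simp +contextual
  simp only [character, root_val, Pi.sub_apply, zpow_sub₀ (hc _), Finset.prod_div_distrib,
    prod_single]

end Lattice

section Ratio

variable {K : Type*} [Field K]

theorem hom_root_eq_segmentProd {ς : Equiv.Perm (Fin 5)} {p : Fin 4 → K} {C : Set (Fin 5 → ℝ)}
    (hC : C ⊆ chamber ς) (χ : Multiplicative (dualMonoid C) →* K)
    (hχ : ∀ l, χ (Multiplicative.ofAdd ⟨simpleRoot ς l, simpleRoot_mem ς l hC⟩) = p l)
    {i j : Fin 5} (hij : ς.symm i ≤ ς.symm j) :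
    χ (Multiplicative.ofAdd ⟨root i j, root_mem_dualMonoid hC hij⟩) =
      segmentProd p (ς.symm i) (ς.symm j) := by
  have decomposition : Multiplicative.ofAdd
      (⟨root i j, root_mem_dualMonoid hC hij⟩ : dualMonoid C) =
        segmentProd (fun m => Multiplicative.ofAdd ⟨simpleRoot ς m, simpleRoot_mem ς m hC⟩)
          (ς.symm i) (ς.symm j) := by
    have inj : Function.Injective (dualMonoid C).subtype.toMultiplicative := Subtype.val_injective
    apply inj
    rw [map_segmentProd]
    exact (by simpa using segmentProd_simpleRoot ς hij :
      segmentProd (fun m => Multiplicative.ofAdd (simpleRoot ς m)) _ _ = _).symm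
  rw [decomposition, map_segmentProd]
  simp only [hχ]

theorem hom_root_mul_hom_root {C : Set (Fin 5 → ℝ)} (χ : Multiplicative (dualMonoid C) →* K)
    {i j : Fin 5} (h : root i j ∈ dualMonoid C) (h' : root j i ∈ dualMonoid C) :
    χ (Multiplicative.ofAdd ⟨root i j, h⟩) * χ (Multiplicative.ofAdd ⟨root j i, h'⟩) = 1 := by
  have add_eq_zero : (⟨root i j, h⟩ + ⟨root j i, h'⟩ : dualMonoid C) = 0 :=
    Subtype.ext ((root_add_root i j i).trans (root_self i))
  rw [← map_mul, ← ofAdd_add, add_eq_zero, ofAdd_zero, map_one]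

open Classical in
/-- The value of the rational function `X_i / X_j` at a point of a chart; `none` stands for
infinity. -/
def chartRatio (P : Equiv.Perm (Fin 5) × (Fin 4 → K)) (i j : Fin 5) : Option K :=
  if P.1.symm i ≤ P.1.symm j then some (segmentProd P.2 (P.1.symm i) (P.1.symm j))
  else if segmentProd P.2 (P.1.symm j) (P.1.symm i) = 0 then none
  else some (segmentProd P.2 (P.1.symm j) (P.1.symm i))⁻¹

theorem chartRatio_eq_of_glue {P Q : Equiv.Perm (Fin 5) × (Fin 4 → K)} (h : Glue K P Q)
    (i j : Fin 5) : chartRatio P i j = chartRatio Q i j := by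
  obtain ⟨χ, hP, hQ⟩ := h
  have eP {i j} := hom_root_eq_segmentProd (p := P.2) Set.inter_subset_left χ hP (i := i) (j := j)
  have eQ {i j} := hom_root_eq_segmentProd (p := Q.2) Set.inter_subset_right χ hQ (i := i) (j := j)
  unfold chartRatio
  rcases le_or_gt (P.1.symm i) (P.1.symm j) with h1 | h1 <;>
    rcases le_or_gt (Q.1.symm i) (Q.1.symm j) with h2 | h2
  · rw [if_pos h1, if_pos h2, ← eP h1, ← eQ h2]
  · have inverse := hom_root_mul_hom_root χ (root_mem_dualMonoid Set.inter_subset_left h1)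
      (root_mem_dualMonoid Set.inter_subset_right h2.le)
    rw [eP h1, eQ h2.le] at inverse
    rw [if_pos h1, if_neg h2.not_ge, if_neg (right_ne_zero_of_mul_eq_one inverse),
      eq_inv_of_mul_eq_one_left inverse]
  · have inverse := hom_root_mul_hom_root χ (root_mem_dualMonoid Set.inter_subset_right h2)
      (root_mem_dualMonoid Set.inter_subset_left h1.le)
    rw [eP h1.le, eQ h2] at inverse
    rw [if_pos h2, if_neg h1.not_ge, if_neg (right_ne_zero_of_mul_eq_one inverse),
      eq_inv_of_mul_eq_one_left inverse]
  · rw [if_neg h1.not_ge, if_neg h2.not_ge, ← eP h1.le, ← eQ h2.le]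

/-- The value of the rational function `X_i / X_j` at a point of the toric variety; `none` stands
for infinity. -/
def ratio (P : ToricVariety K) (i j : Fin 5) : Option K :=
  Quot.lift (fun P => chartRatio P i j) (fun _ _ h => chartRatio_eq_of_glue h i j) P

theorem ratio_chartPoint_succ (ς : Equiv.Perm (Fin 5)) (p : Fin 4 → K) (l : Fin 4) :
    ratio (chartPoint ς p) (ς l.castSucc) (ς l.succ) = some (p l) := by
  simp [ratio, chartPoint, chartRatio, l.castSucc_le_succ, segmentProd_castSucc_succ]

theorem ratio_chartPoint_eq_zero_iff (ς : Equiv.Perm (Fin 5)) (p : Fin 4 → K) (i j : Fin 5) :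
    ratio (chartPoint ς p) i j = some 0 ↔
      ς.symm i ≤ ς.symm j ∧ segmentProd p (ς.symm i) (ς.symm j) = 0 := by
  change chartRatio (ς, p) i j = some 0 ↔ _
  unfold chartRatio
  split_ifs <;> simp_all

theorem ratio_torusPoint {c : Fin 5 → K} (hc : ∀ i, c i ≠ 0) (i j : Fin 5) :
    ratio (torusPoint c) i j = some (c i / c j) := by
  change chartRatio (1, torusCoords c) i j = _
  unfold chartRatio
  split_ifs with hij hzero
  · exact congrArg some (segmentProd_torusCoords hc hij)
  · have hji := segmentProd_torusCoords hc (le_of_not_ge hij)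
    exact absurd (hji.symm.trans hzero) (div_ne_zero (hc j) (hc i))
  · have hji := segmentProd_torusCoords hc (le_of_not_ge hij)
    exact congrArg some ((congrArg Inv.inv hji).trans (inv_div _ _))

end Ratio

section Gluing

variable {K : Type*} [Field K]

/-- The set `{ς 0, …, ς l}`. The rays of the fan correspond to the proper nonempty sets of indices,
and these are the sets of the four rays of the chamber of `ς`. -/
def leadingSet (ς : Equiv.Perm (Fin 5)) (l : Fin 4) : Finset (Fin 5) :=
  (Finset.Iic l.castSucc).map ς.toEmbedding

theorem mem_leadingSet {ς : Equiv.Perm (Fin 5)} {l : Fin 4} {i : Fin 5} :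
    i ∈ leadingSet ς l ↔ ς.symm i ≤ l.castSucc := by
  simp [leadingSet]

/-- The pairing of a character with the ray of the fan that corresponds to `S`. -/
def coweight (S : Finset (Fin 5)) : rootLattice →+ ℤ :=
  ∑ i ∈ S, (Pi.evalAddMonoidHom (fun _ => ℤ) i).comp rootLattice.subtype

theorem coweight_apply (S : Finset (Fin 5)) (m : rootLattice) : coweight S m = ∑ i ∈ S, m.1 i := by
  simp [coweight]

theorem coweight_leadingSet_root (ς : Equiv.Perm (Fin 5)) (l : Fin 4) (k k' : Fin 5) :
    coweight (leadingSet ς l) (root (ς k) (ς k')) =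
      (if k ≤ l.castSucc then 1 else 0) - if k' ≤ l.castSucc then 1 else 0 := by
  simp only [coweight_apply, root_val, Pi.sub_apply, Finset.sum_sub_distrib,
    Finset.sum_pi_single', mem_leadingSet, Equiv.symm_apply_apply]

theorem coweight_leadingSet_simpleRoot (ς : Equiv.Perm (Fin 5)) (l k : Fin 4) :
    coweight (leadingSet ς l) (simpleRoot ς k) = if k = l then 1 else 0 := by
  simp only [simpleRoot, coweight_leadingSet_root, Fin.le_def, Fin.val_castSucc, Fin.val_succ,
    Fin.ext_iff]
  split_ifs <;> omega

/-- A generator of the ray of the fan that corresponds to `S`, scaled to have integral entries. -/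
def rayVector (S : Finset (Fin 5)) (i : Fin 5) : ℝ :=
  (if i ∈ S then 5 else 0) - S.card

theorem sum_rayVector (S : Finset (Fin 5)) : ∑ i, rayVector S i = 0 := by
  simp [rayVector, Finset.sum_sub_distrib, mul_comm]

theorem rayVector_leadingSet_mem_chamber (ς : Equiv.Perm (Fin 5)) (l : Fin 4) :
    rayVector (leadingSet ς l) ∈ chamber ς := by
  refine ⟨sum_rayVector _, fun j k hjk => ?_⟩
  simp only [Function.comp_apply, rayVector, mem_leadingSet, Equiv.symm_apply_apply]
  refine sub_le_sub_right ?_ _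
  split_ifs with hk hj
  · exact le_rfl
  · exact absurd (hjk.trans hk) hj
  · norm_num
  · exact le_rfl

theorem sum_rayVector_mul (S : Finset (Fin 5)) (m : rootLattice) :
    ∑ i, rayVector S i * ((m.1 i : ℤ) : ℝ) = 5 * (coweight S m : ℝ) := by
  have hm : ∑ i, ((m.1 i : ℤ) : ℝ) = 0 := by exact_mod_cast m.2
  simp [rayVector, sub_mul, Finset.sum_sub_distrib, ← Finset.mul_sum, hm, coweight_apply]

theorem coweight_nonneg {S : Finset (Fin 5)} {C : Set (Fin 5 → ℝ)} (hS : rayVector S ∈ C)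
    {m : rootLattice} (hm : m ∈ dualMonoid C) : 0 ≤ coweight S m := by
  have pairing := hm _ hS
  rw [sum_rayVector_mul] at pairing
  exact_mod_cast nonneg_of_mul_nonneg_right pairing (by norm_num)

/-- The `K`-point of the affine toric variety of the cone `C` that lies in the torus orbit of the
face spanned by the rays of the sets `S l`, `l ∈ Z`, and is the limit of the point `c` of the torus:
the value of a character is its value at `c` if it pairs to zero with these rays, and zero
otherwise. -/
def orbitHom {C : Set (Fin 5 → ℝ)} {c : Fin 5 → K} (hc : ∀ i, c i ≠ 0) (S : Fin 4 → Finset (Fin 5))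
    (Z : Finset (Fin 4)) (hS : ∀ l ∈ Z, rayVector (S l) ∈ C) :
    Multiplicative (dualMonoid C) →* K where
  toFun m := character c m.toAdd * ∏ l ∈ Z, 0 ^ (coweight (S l) m.toAdd).toNat
  map_one' := by simp [character_zero]
  map_mul' m m' := by
    have toNat_add (l) (hl : l ∈ Z) := Int.toNat_add
      (coweight_nonneg (hS l hl) m.toAdd.2) (coweight_nonneg (hS l hl) m'.toAdd.2)
    rw [toAdd_mul, AddSubmonoid.coe_add, character_add hc, mul_mul_mul_comm,
      ← Finset.prod_mul_distrib]
    congr 1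
    refine Finset.prod_congr rfl fun l hl => ?_
    rw [map_add, toNat_add l hl, pow_add]

theorem orbitHom_simpleRoot {ς : Equiv.Perm (Fin 5)} {C : Set (Fin 5 → ℝ)} {c : Fin 5 → K}
    (hc : ∀ i, c i ≠ 0) {S : Fin 4 → Finset (Fin 5)} {Z : Finset (Fin 4)}
    (hS : ∀ l ∈ Z, rayVector (S l) ∈ C) (hς : ∀ l ∈ Z, S l = leadingSet ς l) (k : Fin 4)
    (h : simpleRoot ς k ∈ dualMonoid C) :
    orbitHom hc S Z hS (Multiplicative.ofAdd ⟨simpleRoot ς k, h⟩) =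
      Z.piecewise 0 (torusCoords (c ∘ ς)) k := by
  have factor (l) (hl : l ∈ Z) :
      (0 : K) ^ (coweight (S l) (simpleRoot ς k)).toNat = if k = l then 0 else 1 := by
    rw [hς l hl, coweight_leadingSet_simpleRoot]
    split_ifs <;> simp
  change character c (simpleRoot ς k) *
    ∏ l ∈ Z, (0 : K) ^ (coweight (S l) (simpleRoot ς k)).toNat = _
  rw [Finset.prod_congr rfl factor, Finset.prod_ite_eq, simpleRoot, character_root hc]
  by_cases hk : k ∈ Z <;> simp [hk, torusCoords]

theorem chartPoint_piecewise_eq {ς τ : Equiv.Perm (Fin 5)} {Z : Finset (Fin 4)}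
    (hZ : ∀ l ∈ Z, leadingSet ς l = leadingSet τ l) {c : Fin 5 → K} (hc : ∀ i, c i ≠ 0) :
    chartPoint ς (Z.piecewise 0 (torusCoords (c ∘ ς))) =
      chartPoint τ (Z.piecewise 0 (torusCoords (c ∘ τ))) := by
  have ray_mem (l) (hl : l ∈ Z) : rayVector (leadingSet ς l) ∈ chamber ς ∩ chamber τ :=
    ⟨rayVector_leadingSet_mem_chamber ς l, hZ l hl ▸ rayVector_leadingSet_mem_chamber τ l⟩
  exact Quot.sound ⟨orbitHom hc (leadingSet ς) Z ray_mem,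
    fun l => orbitHom_simpleRoot hc ray_mem (fun _ _ => rfl) l _,
    fun l => orbitHom_simpleRoot hc ray_mem hZ l _⟩

theorem torusPoint_eq_chartPoint (ς : Equiv.Perm (Fin 5)) {c : Fin 5 → K} (hc : ∀ i, c i ≠ 0) :
    torusPoint c = chartPoint ς (torusCoords (c ∘ ς)) := by
  simpa using! chartPoint_piecewise_eq (ς := 1) (τ := ς) (Z := ∅) (by simp) hc

theorem chartPoint_mem_torus_iff (ς : Equiv.Perm (Fin 5)) (p : Fin 4 → K) :
    chartPoint ς p ∈ torus K ↔ ∀ l, p l ≠ 0 := by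
  constructor
  · rintro ⟨c, hc, h⟩ l
    have ratio_eq := ratio_chartPoint_succ ς p l
    rw [h, ratio_torusPoint hc, Option.some_inj] at ratio_eq
    exact ratio_eq ▸ div_ne_zero (hc _) (hc _)
  · intro hp
    have hc (i) : segmentProd p (ς.symm i) (Fin.last 4) ≠ 0 := segmentProd_ne_zero hp _ _
    refine ⟨_, hc, ?_⟩
    rw [torusPoint_eq_chartPoint ς hc]
    simp only [Function.comp_def, Equiv.symm_apply_apply, torusCoords_segmentProd hp]

end Gluing

section ChartPoly

open MvPolynomial

variable {n : ℕ} {K : Type*} [Field K]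

variable (n K) in
/-- The factor `∑ X_k / X_n` in the chart coordinates `x_l = X_l / X_{l+1}`. -/
def sumFactor : MvPolynomial (Fin n) K :=
  ∑ k, segmentProd X k (Fin.last n)

/-- The factor `∑ a_k X_0 / X_k` in the chart coordinates `x_l = X_l / X_{l+1}`. -/
def inverseFactor (a : Fin (n + 1) → K) : MvPolynomial (Fin n) K :=
  ∑ k, C (a k) * segmentProd X 0 k

/-- The equation `(∑ X_k) (∑ a_k / X_k) = s` in the chart coordinates `x_l = X_l / X_{l+1}`, with
denominators cleared by the factor `X_0 / X_n = ∏ x_l`. -/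
def chartPoly (a : Fin (n + 1) → K) (s : K) : MvPolynomial (Fin n) K :=
  sumFactor n K * inverseFactor a - C s * ∏ l, X l

theorem segmentProd_apply_zero {k l : Fin (n + 1)} (h : k < l) :
    segmentProd (0 : Fin n → K) k l = 0 := by
  obtain ⟨m, rfl⟩ := Fin.exists_castSucc_eq.2 (h.trans_le (Fin.le_last l)).ne
  exact Finset.prod_eq_zero
    (Finset.mem_filter.2 ⟨Finset.mem_univ m, le_rfl, h⟩) rfl

theorem eval_segmentProd_X (p : Fin n → K) (k l : Fin (n + 1)) :
    eval p (segmentProd X k l) = segmentProd p k l := by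
  simp only [map_segmentProd, eval_X]

theorem eval_sumFactor (p : Fin n → K) :
    eval p (sumFactor n K) = ∑ k, segmentProd p k (Fin.last n) := by
  simp only [sumFactor, map_sum, eval_segmentProd_X]

theorem eval_inverseFactor (p : Fin n → K) (a : Fin (n + 1) → K) :
    eval p (inverseFactor a) = ∑ k, a k * segmentProd p 0 k := by
  simp only [inverseFactor, map_sum, map_mul, eval_C, eval_segmentProd_X]

theorem eval_zero_chartPoly (hn : n ≠ 0) (a : Fin (n + 1) → K) (s : K) :
    eval 0 (chartPoly a s) = a 0 := by
  have sum_eq : eval 0 (sumFactor n K) = 1 := by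
    rw [eval_sumFactor, Fin.sum_univ_castSucc, segmentProd_self]
    simp [segmentProd_apply_zero, Fin.castSucc_lt_last]
  have inverse_eq : eval 0 (inverseFactor a) = a 0 := by
    rw [eval_inverseFactor, Fin.sum_univ_succ, segmentProd_self]
    simp [segmentProd_apply_zero, Fin.succ_pos]
  rw [chartPoly, map_sub, map_mul, map_mul, map_prod, sum_eq, inverse_eq]
  simp [hn]

end ChartPoly

section ChartIdeal

open MvPolynomial

theorem comap_span_singleton_of_isRelPrime {R S Φ : Type*} [CommRing R] [DecompositionMonoid R]
    [CommRing S] [FunLike Φ R S] [RingHomClass Φ R S] {φ : Φ} (hφ : Function.Injective φ) {x F : R}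
    (hx : ∀ s, ∃ (n : ℕ) (q : R), φ x ^ n * s = φ q) (hF : IsRelPrime F x) :
    (Ideal.span {φ F}).comap φ = Ideal.span {F} := by
  ext g
  rw [Ideal.mem_comap, Ideal.mem_span_singleton, Ideal.mem_span_singleton]
  refine ⟨?_, map_dvd φ⟩
  rintro ⟨s, hs⟩
  obtain ⟨n, q, hq⟩ := hx s
  have clear_denominator : x ^ n * g = F * q := by
    apply hφ
    rw [map_mul, map_mul, map_pow, hs, ← hq]
    ring
  exact hF.pow_right.dvd_of_dvd_mul_left ⟨q, clear_denominator⟩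

theorem isRelPrime_prod_X {ι K : Type*} [Fintype ι] [Field K] {F : MvPolynomial ι K}
    (hF : eval 0 F ≠ 0) : IsRelPrime F (∏ i, X i) := by
  refine IsRelPrime.prod_right fun i _ => IsRelPrime.symm ?_
  refine (Irreducible.isRelPrime_iff_not_dvd X_prime.irreducible).2 ?_
  rintro ⟨g, rfl⟩
  simp at hF

theorem eq_of_coweight_leadingSet_eq (ς : Equiv.Perm (Fin 5)) {m m' : rootLattice}
    (h : ∀ l, coweight (leadingSet ς l) m = coweight (leadingSet ς l) m') : m = m' := by
  have partial_sums (k : Fin 5) : ∑ j ∈ Finset.Iic k, (m - m').1 (ς j) = 0 := by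
    induction k using Fin.lastCases with
    | last =>
      rw [show Finset.Iic (Fin.last 4) = Finset.univ from rfl,
        Equiv.sum_comp ς fun i => (m - m').1 i]
      exact (m - m').2
    | cast l =>
      have := sub_eq_zero.2 (h l)
      rwa [← map_sub, coweight_apply, leadingSet, Finset.sum_map] at this
  rw [← sub_eq_zero]
  ext i
  simpa using eq_zero_of_sum_Iic_eq_zero partial_sums (ς.symm i)

theorem coweight_linearCombination_simpleRoot (ς : Equiv.Perm (Fin 5)) (l : Fin 4)
    (d : Fin 4 →₀ ℕ) :
    coweight (leadingSet ς l) (Finsupp.linearCombination ℕ (simpleRoot ς) d) = d l := by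
  simp [Finsupp.linearCombination_apply, Finsupp.sum_fintype, coweight_leadingSet_simpleRoot]

variable {K : Type*} [Field K]

theorem restrictToTorus_eq_mapDomain (ς : Equiv.Perm (Fin 5)) :
    restrictToTorus K ς = AddMonoidAlgebra.mapDomainAlgHom K K
      (Finsupp.linearCombination ℕ (simpleRoot ς)).toAddMonoidHom := by
  apply MvPolynomial.algHom_ext
  intro l
  rw [restrictToTorus, aeval_X]
  refine (AddMonoidAlgebra.mapDomain_single.trans ?_).symm
  simp

theorem restrictToTorus_injective (ς : Equiv.Perm (Fin 5)) :
    Function.Injective (restrictToTorus K ς) := by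
  rw [restrictToTorus_eq_mapDomain]
  refine AddMonoidAlgebra.mapDomain_injective fun d d' h => Finsupp.ext fun l => ?_
  have := congrArg (coweight (leadingSet ς l)) h
  simpa [coweight_linearCombination_simpleRoot] using this

theorem exists_restrictToTorus_eq_single (ς : Equiv.Perm (Fin 5)) {m : rootLattice}
    (hm : ∀ l, 0 ≤ coweight (leadingSet ς l) m) (r : K) :
    ∃ q, restrictToTorus K ς q = AddMonoidAlgebra.single m r := by
  let d : Fin 4 →₀ ℕ := Finsupp.equivFunOnFinite.symm fun l => (coweight (leadingSet ς l) m).toNat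
  have hd : Finsupp.linearCombination ℕ (simpleRoot ς) d = m :=
    eq_of_coweight_leadingSet_eq ς fun l => by
      simp [coweight_linearCombination_simpleRoot, d, hm l]
  refine ⟨monomial d r, ?_⟩
  rw [restrictToTorus_eq_mapDomain, ← hd]
  exact AddMonoidAlgebra.mapDomain_single

theorem restrictToTorus_segmentProd_X (ς : Equiv.Perm (Fin 5)) {k l : Fin 5} (h : k ≤ l) :
    restrictToTorus K ς (segmentProd X k l) = AddMonoidAlgebra.single (root (ς k) (ς l)) 1 := by
  have map_X (m) : restrictToTorus K ς (X m) =
      AddMonoidAlgebra.of K rootLattice (Multiplicative.ofAdd (simpleRoot ς m)) :=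
    aeval_X _ m
  simp only [map_segmentProd, map_X]
  rw [← map_segmentProd, segmentProd_simpleRoot ς h]
  rfl

theorem restrictToTorus_prod_X (ς : Equiv.Perm (Fin 5)) :
    restrictToTorus K ς (∏ l, X l) =
      AddMonoidAlgebra.single (root (ς 0) (ς (Fin.last 4))) 1 := by
  rw [← segmentProd_zero_last, restrictToTorus_segmentProd_X ς (Fin.zero_le _)]

theorem exists_prod_X_pow_mul_eq (ς : Equiv.Perm (Fin 5)) (h : AddMonoidAlgebra K rootLattice) :
    ∃ (n : ℕ) (q : MvPolynomial (Fin 4) K),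
      restrictToTorus K ς (∏ l, X l) ^ n * h = restrictToTorus K ς q := by
  induction h using AddMonoidAlgebra.induction_linear with
  | zero => exact ⟨0, 0, by simp⟩
  | add f g hf hg =>
    obtain ⟨n, q, hq⟩ := hf
    obtain ⟨n', q', hq'⟩ := hg
    refine ⟨n + n', (∏ l, X l) ^ n' * q + (∏ l, X l) ^ n * q', ?_⟩
    rw [map_add, map_mul, map_mul, ← hq, ← hq', map_pow, map_pow]
    ring
  | single m r =>
    let n : ℕ := ∑ l, (coweight (leadingSet ς l) m).natAbs
    obtain ⟨q, hq⟩ := exists_restrictToTorus_eq_single ς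
      (m := n • root (ς 0) (ς (Fin.last 4)) + m) (fun l => by
        have natAbs_le : (coweight (leadingSet ς l) m).natAbs ≤ n :=
          Finset.single_le_sum (f := fun l => (coweight (leadingSet ς l) m).natAbs)
            (fun _ _ => zero_le) (Finset.mem_univ l)
        have coweight_root : coweight (leadingSet ς l) (root (ς 0) (ς (Fin.last 4))) = 1 := by
          rw [coweight_leadingSet_root, if_pos (Fin.zero_le _),
            if_neg (Fin.castSucc_lt_last l).not_ge, sub_zero]
        rw [map_add, map_nsmul, coweight_root, nsmul_one]
        omega) r
    refine ⟨n, q, ?_⟩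
    rw [hq, restrictToTorus_prod_X, AddMonoidAlgebra.single_pow, one_pow,
      AddMonoidAlgebra.single_mul_single, one_mul]

theorem single_root_mul_equation (ς : Equiv.Perm (Fin 5)) (a : Fin 6 → K) :
    AddMonoidAlgebra.single (root (ς 0) (ς (Fin.last 4))) 1 * equation a =
      (∑ k, AddMonoidAlgebra.single (root (ς k) (ς (Fin.last 4))) 1) *
        (∑ k, AddMonoidAlgebra.single (root (ς 0) (ς k)) (a (ς k).castSucc)) -
      AddMonoidAlgebra.single (root (ς 0) (ς (Fin.last 4))) (a (Fin.last 5)) := by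
  have reindex : ∑ i, ∑ j, AddMonoidAlgebra.single (root i j) (a j.castSucc) =
      ∑ k, ∑ k', AddMonoidAlgebra.single (root (ς k) (ς k')) (a (ς k').castSucc) := by
    rw [← Equiv.sum_comp ς]
    exact Finset.sum_congr rfl fun k _ => (Equiv.sum_comp ς _).symm
  have exchange (k k' : Fin 5) : root (ς 0) (ς (Fin.last 4)) + root (ς k) (ς k') =
      root (ς k) (ς (Fin.last 4)) + root (ς 0) (ς k') :=
    Subtype.ext (by simp only [AddSubgroup.coe_add, root_val]; abel)
  rw [equation, reindex, mul_sub, Finset.sum_mul_sum, Finset.mul_sum]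
  simp only [Finset.mul_sum, AddMonoidAlgebra.single_mul_single, exchange, one_mul, add_zero]

theorem restrictToTorus_chartPoly (ς : Equiv.Perm (Fin 5)) (a : Fin 6 → K) :
    restrictToTorus K ς (chartPoly (fun k => a (ς k).castSucc) (a (Fin.last 5))) =
      AddMonoidAlgebra.single (root (ς 0) (ς (Fin.last 4))) 1 * equation a := by
  have map_C (r : K) : restrictToTorus K ς (C r) = AddMonoidAlgebra.single 0 r :=
    (restrictToTorus K ς).commutes r
  simp only [chartPoly, sumFactor, inverseFactor, map_sub, map_mul, map_sum, map_C,
    restrictToTorus_segmentProd_X ς (Fin.le_last _),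
    restrictToTorus_segmentProd_X ς (Fin.zero_le _), restrictToTorus_prod_X,
    AddMonoidAlgebra.single_mul_single, zero_add, mul_one, single_root_mul_equation]

theorem isUnit_single_root (i j : Fin 5) :
    IsUnit (AddMonoidAlgebra.single (root i j) 1 : AddMonoidAlgebra K rootLattice) :=
  (Group.isUnit (Multiplicative.ofAdd (root i j))).map (AddMonoidAlgebra.of K rootLattice)

theorem chartIdeal_eq_span {a : Fin 6 → K} {ς : Equiv.Perm (Fin 5)} (ha : a (ς 0).castSucc ≠ 0) :
    chartIdeal a ς =
      Ideal.span {chartPoly (fun k => a (ς k).castSucc) (a (Fin.last 5))} := by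
  have relPrime : IsRelPrime (chartPoly (fun k => a (ς k).castSucc) (a (Fin.last 5))) (∏ l, X l) :=
    isRelPrime_prod_X (by rwa [eval_zero_chartPoly four_ne_zero])
  rw [← comap_span_singleton_of_isRelPrime (restrictToTorus_injective ς)
    (exists_prod_X_pow_mul_eq ς) relPrime, restrictToTorus_chartPoly,
    Ideal.span_singleton_mul_left_unit (isUnit_single_root _ _), chartIdeal]

end ChartIdeal

section BridgeDet

open Matrix

variable {n : ℕ} {R : Type*} [CommRing R]

theorem det_diagonal_mul_scalar_sub_vecMulVec (w : Fin n → R) (t : R) :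
    (diagonal w * (scalar (Fin n) t - vecMulVec 1 w)).det * t =
      t ^ n * (t - ∑ k, w k) * ∏ k, w k := by
  rw [det_mul, det_diagonal, ← eval_charpoly, charpoly_vecMulVec]
  cases n <;> simp [dotProduct]
  ring

variable (n R) in
/-- The lower triangular matrix of ones, which takes a vector to its partial sums. -/
def partialSumMatrix : Matrix (Fin n) (Fin n) R :=
  of fun l k => if k ≤ l then 1 else 0

theorem det_partialSumMatrix : (partialSumMatrix n R).det = 1 := by
  rw [det_of_isLowerTriangular (partialSumMatrix n R) fun l k hlk =>
    if_neg (OrderDual.toDual_lt_toDual.1 hlk).not_ge]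
  simp [partialSumMatrix]

theorem partialSumMatrix_mulVec (v : Fin n → R) :
    partialSumMatrix n R *ᵥ v = fun l => ∑ k ∈ Finset.Iic l, v k := by
  ext l
  simp only [mulVec, dotProduct, partialSumMatrix, of_apply, ite_mul, one_mul, zero_mul]
  rw [← Finset.sum_filter, Finset.filter_ge_eq_Iic]

theorem partialSumMatrix_mul_diagonal_mul_transpose (v : Fin n → R) :
    partialSumMatrix n R * diagonal v * (partialSumMatrix n R)ᵀ =
      of fun l m => ∑ k ∈ Finset.Iic (l ⊓ m), v k := by
  ext l m
  simp only [mul_apply (M := _ * _), mul_diagonal, partialSumMatrix, of_apply, transpose_apply,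
    ite_mul, one_mul, zero_mul, mul_ite, mul_one, mul_zero, ← ite_and, ← Finset.sum_filter]
  exact Finset.sum_congr (by ext; simp [and_comm]) fun _ _ => rfl

theorem det_sum_Iic_mul_sub_sum_Iic (w : Fin (n + 1) → R) :
    (of fun l m : Fin n => (∑ k ∈ Finset.Iic (l ⊓ m).castSucc, w k) *
        (∑ k, w k - ∑ k ∈ Finset.Iic (l ⊔ m).castSucc, w k)).det * ∑ k, w k =
      (∑ k, w k) ^ n * ∏ k, w k := by
  set σ := ∑ k, w k with hσ
  let S : Fin n → R := fun l => ∑ k ∈ Finset.Iic l.castSucc, w k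
  let v : Fin n → R := fun k => w k.castSucc
  have S_eq : S = fun l => ∑ k ∈ Finset.Iic l, v k := by
    ext l
    simp only [S, v, ← Fin.map_castSuccEmb_Iic, Finset.sum_map, Fin.coe_castSuccEmb]
  have mulVec_one : (partialSumMatrix n R * diagonal v) *ᵥ 1 = S := by
    rw [← mulVec_mulVec, S_eq, ← partialSumMatrix_mulVec]
    congr 1
    ext k
    simp [mulVec_diagonal]
  have S_inf_mul_S_sup (l m : Fin n) : S (l ⊓ m) * S (l ⊔ m) = S l * S m := by
    rcases le_total l m with h | h <;> simp [h, mul_comm]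
  have factorization : (of fun l m => S (l ⊓ m) * (σ - S (l ⊔ m))) =
      partialSumMatrix n R * (diagonal v * (scalar (Fin n) σ - vecMulVec 1 v)) *
        (partialSumMatrix n R)ᵀ := by
    rw [← Matrix.mul_assoc, Matrix.mul_sub, mul_vecMulVec, mulVec_one, Matrix.sub_mul,
      vecMulVec_mul, vecMul_transpose, partialSumMatrix_mulVec, ← S_eq,
      ← (scalar_commute σ (.all σ) _).eq, Matrix.mul_assoc,
      partialSumMatrix_mul_diagonal_mul_transpose]
    ext l m
    simp [mul_sub, S_inf_mul_S_sup, mul_comm, ← congrFun S_eq (l ⊓ m), vecMulVec]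
  calc (of fun l m => S (l ⊓ m) * (σ - S (l ⊔ m))).det * σ
      = σ ^ n * (σ - ∑ k, v k) * ∏ k, v k := by
        rw [factorization, det_mul, det_mul, det_transpose, det_partialSumMatrix, one_mul, mul_one,
          det_diagonal_mul_scalar_sub_vecMulVec]
    _ = σ ^ n * ∏ k, w k := by
        rw [hσ, Fin.sum_univ_castSucc, Fin.prod_univ_castSucc, add_sub_cancel_left]
        ring

end BridgeDet

section EulerDeriv

open MvPolynomial

/-- `p` is a singular point of the affine hypersurface `F = 0`. -/
def IsSingularZero {R σ : Type*} [CommSemiring R] (F : MvPolynomial σ R) (p : σ → R) : Prop :=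
  eval p F = 0 ∧ ∀ i, eval p (pderiv i F) = 0

/-- The Hessian matrix of `F` at `p`. -/
def hessian {R σ : Type*} [CommSemiring R] (F : MvPolynomial σ R) (p : σ → R) : Matrix σ σ R :=
  Matrix.of fun i j => eval p (pderiv i (pderiv j F))

/-- The derivation `x_i ∂/∂x_i`, for which monomials are eigenvectors. -/
def eulerDeriv {R σ : Type*} [CommSemiring R] (i : σ) :
    Derivation R (MvPolynomial σ R) (MvPolynomial σ R) :=
  (X i : MvPolynomial σ R) • pderiv i

section

variable {R σ : Type*} [CommSemiring R] {F : MvPolynomial σ R} {p : σ → R}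

theorem eval_eulerDeriv (i : σ) : eval p (eulerDeriv i F) = p i * eval p (pderiv i F) := by
  simp [eulerDeriv]

theorem isSingularZero_iff_eulerDeriv [NoZeroDivisors R] (hp : ∀ i, p i ≠ 0) :
    IsSingularZero F p ↔ eval p F = 0 ∧ ∀ i, eval p (eulerDeriv i F) = 0 := by
  simp [IsSingularZero, eval_eulerDeriv, hp]

theorem IsSingularZero.eval_eulerDeriv_eulerDeriv (h : IsSingularZero F p) (i j : σ) :
    eval p (eulerDeriv i (eulerDeriv j F)) = p i * hessian F p i j * p j := by
  simp [eulerDeriv, hessian, Derivation.leibniz, h.2 j]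
  ring

theorem eulerDeriv_prod_X [DecidableEq σ] (i : σ) (s : Finset σ) :
    eulerDeriv i (∏ j ∈ s, X j : MvPolynomial σ R) = if i ∈ s then ∏ j ∈ s, X j else 0 := by
  induction s using Finset.induction_on with
  | empty => simp
  | insert j s hj ih =>
    rw [Finset.prod_insert hj, Derivation.leibniz, ih]
    by_cases hij : i = j
    · subst hij
      simp [eulerDeriv, hj, mul_comm]
    · simp [eulerDeriv, hij, pderiv_X_of_ne (Ne.symm hij)]

end

theorem IsSingularZero.det_eulerDeriv_eulerDeriv {R σ : Type*} [CommRing R] [Fintype σ]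
    [DecidableEq σ] {F : MvPolynomial σ R} {p : σ → R} (h : IsSingularZero F p) :
    (Matrix.of fun i j => eval p (eulerDeriv i (eulerDeriv j F))).det =
      (∏ i, p i) * (hessian F p).det * ∏ i, p i := by
  rw [← Matrix.det_diagonal, ← Matrix.det_mul, ← Matrix.det_mul]
  congr 1
  ext i j
  simp [h.eval_eulerDeriv_eulerDeriv]

theorem IsAffineNode.isSingularZero {K : Type*} [Field K] {n : ℕ} {F : MvPolynomial (Fin n) K}
    {p : Fin n → K} (h : IsAffineNode (Ideal.span {F}) p) : IsSingularZero F p := by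
  obtain ⟨G, hG, h0, h1, -⟩ := h
  obtain ⟨q, rfl⟩ : G ∣ F := by
    rw [← Ideal.mem_span_singleton, ← hG]
    exact Ideal.mem_span_singleton_self F
  exact ⟨by simp [h0], fun i => by simp [Derivation.leibniz, h0, h1]⟩

end EulerDeriv

section SingularZeros

open MvPolynomial

variable {n : ℕ} {K : Type*} [Field K]

theorem eulerDeriv_segmentProd (l : Fin n) (i j : Fin (n + 1)) :
    eulerDeriv l (segmentProd X i j : MvPolynomial (Fin n) K) =
      if i ≤ l.castSucc ∧ l.castSucc < j then segmentProd X i j else 0 := by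
  simp [segmentProd, eulerDeriv_prod_X]

variable (K) in
/-- The terms of `sumFactor n K` with index at most `j`. -/
def headSum (j : Fin (n + 1)) : MvPolynomial (Fin n) K :=
  ∑ k ∈ Finset.Iic j, segmentProd X k (Fin.last n)

/-- The terms of `inverseFactor a` with index at least `j`. -/
def tailSum (a : Fin (n + 1) → K) (j : Fin (n + 1)) : MvPolynomial (Fin n) K :=
  ∑ k ∈ Finset.Ici j, C (a k) * segmentProd X 0 k

theorem headSum_last : headSum K (Fin.last n) = sumFactor n K :=
  Finset.sum_congr (by ext k; simp [Fin.le_last]) fun _ _ => rfl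

theorem tailSum_zero (a : Fin (n + 1) → K) : tailSum a 0 = inverseFactor a :=
  Finset.sum_congr (by ext k; simp) fun _ _ => rfl

theorem eulerDeriv_headSum (l : Fin n) (j : Fin (n + 1)) :
    eulerDeriv l (headSum K j) = headSum K (l.castSucc ⊓ j) := by
  simp only [headSum, map_sum, eulerDeriv_segmentProd, Fin.castSucc_lt_last, and_true]
  rw [← Finset.sum_filter]
  congr 1
  ext k
  simp [and_comm]

theorem eulerDeriv_tailSum (a : Fin (n + 1) → K) (l : Fin n) (j : Fin (n + 1)) :
    eulerDeriv l (tailSum a j) = tailSum a (l.succ ⊔ j) := by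
  simp only [tailSum, map_sum, Derivation.leibniz, eulerDeriv_segmentProd, Fin.zero_le, true_and,
    derivation_C, add_zero, smul_eq_mul, mul_ite, mul_zero]
  rw [← Finset.sum_filter]
  congr 1
  ext k
  simp [and_comm, Fin.castSucc_lt_iff_succ_le]

theorem eulerDeriv_chartPoly (a : Fin (n + 1) → K) (s : K) (l : Fin n) :
    eulerDeriv l (chartPoly a s) = headSum K l.castSucc * inverseFactor a +
      sumFactor n K * tailSum a l.succ - C s * ∏ m, X m := by
  rw [chartPoly, ← headSum_last, ← tailSum_zero]
  simp [Derivation.leibniz, eulerDeriv_headSum, eulerDeriv_tailSum, eulerDeriv_prod_X, Fin.le_last]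
  ring

theorem eulerDeriv_eulerDeriv_chartPoly (a : Fin (n + 1) → K) (s : K) (l m : Fin n) :
    eulerDeriv l (eulerDeriv m (chartPoly a s)) =
      headSum K (l ⊓ m).castSucc * inverseFactor a + headSum K l.castSucc * tailSum a m.succ +
        headSum K m.castSucc * tailSum a l.succ + sumFactor n K * tailSum a (l ⊔ m).succ -
        C s * ∏ m, X m := by
  rw [eulerDeriv_chartPoly, ← headSum_last, ← tailSum_zero]
  simp [Derivation.leibniz, eulerDeriv_headSum, eulerDeriv_tailSum, eulerDeriv_prod_X, Fin.le_last,
    Fin.strictMono_castSucc.monotone.map_inf, Fin.strictMono_succ.monotone.map_sup]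
  ring

theorem sum_Ici_succ (w : Fin (n + 1) → K) (l : Fin n) :
    ∑ k ∈ Finset.Ici l.succ, w k = ∑ k, w k - ∑ k ∈ Finset.Iic l.castSucc, w k := by
  have : Finset.Ici l.succ = (Finset.Iic l.castSucc)ᶜ := by
    ext k
    simp [Fin.castSucc_lt_iff_succ_le]
  rw [this, eq_sub_iff_add_eq, Finset.sum_compl_add_sum]

theorem eval_headSum (p : Fin n → K) (j : Fin (n + 1)) :
    eval p (headSum K j) = ∑ k ∈ Finset.Iic j, segmentProd p k (Fin.last n) := by
  simp only [headSum, map_sum, eval_segmentProd_X]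

theorem eval_tailSum (p : Fin n → K) (a : Fin (n + 1) → K) (j : Fin (n + 1)) :
    eval p (tailSum a j) = ∑ k ∈ Finset.Ici j, a k * segmentProd p 0 k := by
  simp only [tailSum, map_sum, map_mul, eval_C, eval_segmentProd_X]

theorem eval_chartPoly (p : Fin n → K) (a : Fin (n + 1) → K) (s : K) :
    eval p (chartPoly a s) =
      eval p (sumFactor n K) * eval p (inverseFactor a) - s * ∏ l, p l := by
  simp only [chartPoly, map_sub, map_mul, eval_C, map_prod, eval_X]

theorem IsSingularZero.segmentProd_mul_eq {a : Fin (n + 1) → K} {s : K} {p : Fin n → K}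
    (h : IsSingularZero (chartPoly a s) p) (k : Fin (n + 1)) :
    segmentProd p k (Fin.last n) * eval p (inverseFactor a) =
      eval p (sumFactor n K) * (a k * segmentProd p 0 k) := by
  rw [← sub_eq_zero]
  refine eq_zero_of_sum_Iic_eq_zero (w := fun k =>
    segmentProd p k (Fin.last n) * eval p (inverseFactor a) -
      eval p (sumFactor n K) * (a k * segmentProd p 0 k)) (fun j => ?_) k
  rw [Finset.sum_sub_distrib, ← Finset.sum_mul, ← Finset.mul_sum]
  induction j using Fin.lastCases with
  | last => rw [← Fin.top_eq_last, Finset.Iic_top, Fin.top_eq_last, ← eval_sumFactor,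
      ← eval_inverseFactor, sub_self]
  | cast l =>
    -- The difference of the equation and its derivative compares the two partial sums up to `l`.
    have hzero := h.1
    have hderiv : eval p (eulerDeriv l (chartPoly a s)) = 0 := by
      rw [eval_eulerDeriv, h.2, mul_zero]
    rw [eval_chartPoly] at hzero
    simp only [eulerDeriv_chartPoly, map_sub, map_add, map_mul, eval_C, map_prod, eval_X,
      eval_headSum, eval_tailSum, sum_Ici_succ, ← eval_inverseFactor] at hderiv
    linear_combination hderiv - hzero

variable {c : Fin (n + 1) → K} (hc : ∀ k, c k ≠ 0)
include hc

theorem eval_torusCoords_headSum (j : Fin (n + 1)) :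
    eval (torusCoords c) (headSum K j) = (∑ k ∈ Finset.Iic j, c k) / c (Fin.last n) := by
  simp only [eval_headSum, segmentProd_torusCoords hc (Fin.le_last _), Finset.sum_div]

theorem eval_torusCoords_tailSum (a : Fin (n + 1) → K) (j : Fin (n + 1)) :
    eval (torusCoords c) (tailSum a j) = c 0 * ∑ k ∈ Finset.Ici j, a k / c k := by
  simp only [eval_tailSum, segmentProd_torusCoords hc (Fin.zero_le _), Finset.mul_sum]
  exact Finset.sum_congr rfl fun k _ => by ring

theorem prod_torusCoords : ∏ l, torusCoords c l = c 0 / c (Fin.last n) := by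
  rw [← segmentProd_zero_last, segmentProd_torusCoords hc (Fin.zero_le _)]

theorem eval_torusCoords_sumFactor :
    eval (torusCoords c) (sumFactor n K) = (∑ k, c k) / c (Fin.last n) := by
  simp only [eval_sumFactor, segmentProd_torusCoords hc (Fin.le_last _), Finset.sum_div]

theorem eval_torusCoords_inverseFactor (a : Fin (n + 1) → K) :
    eval (torusCoords c) (inverseFactor a) = c 0 * ∑ k, a k / c k := by
  simp only [eval_inverseFactor, segmentProd_torusCoords hc (Fin.zero_le _), Finset.mul_sum]
  exact Finset.sum_congr rfl fun k _ => by ring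

theorem eval_torusCoords_chartPoly (a : Fin (n + 1) → K) (s : K) :
    eval (torusCoords c) (chartPoly a s) =
      c 0 / c (Fin.last n) * ((∑ k, c k) * (∑ k, a k / c k) - s) := by
  simp only [eval_chartPoly, prod_torusCoords hc,
    eval_torusCoords_sumFactor hc, eval_torusCoords_inverseFactor hc]
  ring

theorem eval_torusCoords_eulerDeriv_chartPoly (a : Fin (n + 1) → K) (s : K) (l : Fin n) :
    eval (torusCoords c) (eulerDeriv l (chartPoly a s)) =
      c 0 / c (Fin.last n) * ((∑ k ∈ Finset.Iic l.castSucc, c k) * (∑ k, a k / c k) +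
        (∑ k, c k) * (∑ k, a k / c k - ∑ k ∈ Finset.Iic l.castSucc, a k / c k) - s) := by
  simp only [eulerDeriv_chartPoly, map_sub, map_add, map_mul, eval_C, map_prod, eval_X,
    prod_torusCoords hc, eval_torusCoords_headSum hc, eval_torusCoords_tailSum hc,
    eval_torusCoords_sumFactor hc, eval_torusCoords_inverseFactor hc, sum_Ici_succ]
  ring

theorem eval_torusCoords_eulerDeriv_eulerDeriv_chartPoly (a : Fin (n + 1) → K) (s : K)
    (l m : Fin n) :
    eval (torusCoords c) (eulerDeriv l (eulerDeriv m (chartPoly a s))) =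
      c 0 / c (Fin.last n) *
        ((∑ k ∈ Finset.Iic (l ⊓ m).castSucc, c k) * (∑ k, a k / c k) +
          (∑ k ∈ Finset.Iic l.castSucc, c k) *
            (∑ k, a k / c k - ∑ k ∈ Finset.Iic m.castSucc, a k / c k) +
          (∑ k ∈ Finset.Iic m.castSucc, c k) *
            (∑ k, a k / c k - ∑ k ∈ Finset.Iic l.castSucc, a k / c k) +
          (∑ k, c k) * (∑ k, a k / c k - ∑ k ∈ Finset.Iic (l ⊔ m).castSucc, a k / c k) - s) := by
  simp only [eulerDeriv_eulerDeriv_chartPoly, map_sub, map_add, map_mul, eval_C, map_prod, eval_X,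
    prod_torusCoords hc, eval_torusCoords_headSum hc, eval_torusCoords_tailSum hc,
    eval_torusCoords_sumFactor hc, eval_torusCoords_inverseFactor hc, sum_Ici_succ]
  ring

theorem torusCoords_ne_zero (l : Fin n) : torusCoords c l ≠ 0 :=
  div_ne_zero (hc _) (hc _)

theorem isSingularZero_chartPoly_torusCoords_iff {a : Fin (n + 1) → K} {s : K} (hs : s ≠ 0) :
    IsSingularZero (chartPoly a s) (torusCoords c) ↔
      ∑ k, c k ≠ 0 ∧ ∀ k, s * c k ^ 2 = (∑ k, c k) ^ 2 * a k := by
  constructor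
  · intro h
    have hzero : (∑ k, c k) * (∑ k, a k / c k) = s := by
      have := h.1
      rwa [eval_torusCoords_chartPoly hc, mul_eq_zero_iff_left (div_ne_zero (hc _) (hc _)),
        sub_eq_zero] at this
    refine ⟨left_ne_zero_of_mul (hzero.trans_ne hs), fun k => ?_⟩
    have terms_eq := h.segmentProd_mul_eq k
    rw [eval_torusCoords_sumFactor hc, eval_torusCoords_inverseFactor hc,
      segmentProd_torusCoords hc (Fin.zero_le _), segmentProd_torusCoords hc (Fin.le_last _)]
      at terms_eq
    have := hc k
    have := hc 0
    have := hc (Fin.last n)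
    field_simp at terms_eq
    linear_combination (∑ k, c k) * terms_eq - c k ^ 2 * hzero
  · rintro ⟨hσ, ha⟩
    have ratio_eq (k : Fin (n + 1)) : a k / c k = s / (∑ k, c k) ^ 2 * c k := by
      have := hc k
      field_simp
      linear_combination -ha k
    simp only [isSingularZero_iff_eulerDeriv (torusCoords_ne_zero hc),
      eval_torusCoords_chartPoly hc, eval_torusCoords_eulerDeriv_chartPoly hc, ratio_eq,
      ← Finset.mul_sum]
    exact ⟨by field_simp; ring, fun l => by field_simp; ring⟩

theorem det_hessian_chartPoly_torusCoords_ne_zero (h2 : (2 : K) ≠ 0) {a : Fin (n + 1) → K} {s : K}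
    (hs : s ≠ 0) (h : IsSingularZero (chartPoly a s) (torusCoords c)) :
    (hessian (chartPoly a s) (torusCoords c)).det ≠ 0 := by
  obtain ⟨hσ, ha⟩ := (isSingularZero_chartPoly_torusCoords_iff hc hs).1 h
  set σ := ∑ k, c k with hσ_def
  have ratio_eq (k : Fin (n + 1)) : a k / c k = s / σ ^ 2 * c k := by
    have := hc k
    field_simp
    linear_combination -ha k
  have eulerDeriv_eq : (Matrix.of fun l m => eval (torusCoords c)
      (eulerDeriv l (eulerDeriv m (chartPoly a s)))) =
      (c 0 / c (Fin.last n) * (2 * (s / σ ^ 2))) •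
        Matrix.of fun l m : Fin n => (∑ k ∈ Finset.Iic (l ⊓ m).castSucc, c k) *
          (σ - ∑ k ∈ Finset.Iic (l ⊔ m).castSucc, c k) := by
    ext l m
    simp only [Matrix.smul_apply, Matrix.of_apply, smul_eq_mul,
      eval_torusCoords_eulerDeriv_eulerDeriv_chartPoly hc, ratio_eq, ← Finset.mul_sum, ← hσ_def]
    have hs_eq : s = s / σ ^ 2 * σ ^ 2 := by field_simp
    rcases le_total l m with hlm | hlm
    all_goals
      simp only [hlm, inf_of_le_left, inf_of_le_right, sup_of_le_left, sup_of_le_right]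
      linear_combination -(c 0 / c (Fin.last n)) * hs_eq
  have bridge_ne_zero : (Matrix.of fun l m : Fin n =>
      (∑ k ∈ Finset.Iic (l ⊓ m).castSucc, c k) *
        (σ - ∑ k ∈ Finset.Iic (l ⊔ m).castSucc, c k)).det ≠ 0 := by
    refine left_ne_zero_of_mul ((det_sum_Iic_mul_sub_sum_Iic c).trans_ne ?_)
    exact mul_ne_zero (pow_ne_zero n hσ) (Finset.prod_ne_zero_iff.2 fun k _ => hc k)
  refine right_ne_zero_of_mul (left_ne_zero_of_mul (h.det_eulerDeriv_eulerDeriv.symm.trans_ne ?_))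
  rw [eulerDeriv_eq, Matrix.det_smul]
  exact mul_ne_zero (pow_ne_zero _ (mul_ne_zero (div_ne_zero (hc _) (hc _))
    (mul_ne_zero h2 (div_ne_zero hs (pow_ne_zero 2 hσ))))) bridge_ne_zero

theorem isAffineNode_chartPoly_torusCoords_iff (h2 : (2 : K) ≠ 0) {a : Fin (n + 1) → K} {s : K}
    (hs : s ≠ 0) :
    IsAffineNode (Ideal.span {chartPoly a s}) (torusCoords c) ↔
      ∑ k, c k ≠ 0 ∧ ∀ k, s * c k ^ 2 = (∑ k, c k) ^ 2 * a k := by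
  rw [← isSingularZero_chartPoly_torusCoords_iff hc hs]
  exact ⟨IsAffineNode.isSingularZero, fun h =>
    ⟨_, rfl, h.1, h.2, det_hessian_chartPoly_torusCoords_ne_zero hc h2 hs h⟩⟩

end SingularZeros

section BoundaryNodes

open MvPolynomial

theorem pderiv_prod_X {R σ : Type*} [CommSemiring R] [DecidableEq σ] {s : Finset σ} {i : σ}
    (hi : i ∈ s) : pderiv i (∏ j ∈ s, X j : MvPolynomial σ R) = ∏ j ∈ s.erase i, X j := by
  have h : X i * pderiv i (∏ j ∈ s, X j : MvPolynomial σ R) = X i * ∏ j ∈ s.erase i, X j := by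
    rw [Finset.mul_prod_erase s _ hi]
    exact (eulerDeriv_prod_X i s).trans (if_pos hi)
  exact X_mul_cancel_left_iff.1 h

theorem hessian_mul_sub_of_eval_eq_zero {R σ : Type*} [CommRing R] {F G H : MvPolynomial σ R}
    {p : σ → R} (hF : eval p F = 0) (hG : eval p G = 0) (i j : σ) :
    hessian (F * G - H) p i j = eval p (pderiv i F) * eval p (pderiv j G) +
      eval p (pderiv j F) * eval p (pderiv i G) - hessian H p i j := by
  simp [hessian, Derivation.leibniz, hF, hG]
  ring

section

variable {n : ℕ} {K : Type*} [Field K] {a : Fin (n + 1) → K} {s : K} {p : Fin n → K}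

theorem IsSingularZero.eval_sumFactor_eq_zero (h : IsSingularZero (chartPoly a s) p) (ha : a 0 ≠ 0)
    (hp : ∏ l, p l = 0) : eval p (sumFactor n K) = 0 := by
  have first_term := h.segmentProd_mul_eq 0
  rw [segmentProd_zero_last, hp, segmentProd_self, zero_mul, mul_one, eq_comm, mul_eq_zero]
    at first_term
  exact first_term.resolve_right ha

theorem IsSingularZero.eval_inverseFactor_eq_zero (h : IsSingularZero (chartPoly a s) p)
    (ha : a 0 ≠ 0) (hp : ∏ l, p l = 0) : eval p (inverseFactor a) = 0 := by
  have last_term := h.segmentProd_mul_eq (Fin.last n)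
  rwa [segmentProd_self, h.eval_sumFactor_eq_zero ha hp, one_mul, zero_mul] at last_term

theorem IsSingularZero.exists_ne_eq_zero (h : IsSingularZero (chartPoly a s) p) (ha : a 0 ≠ 0)
    (hs : s ≠ 0) (hp : ∏ l, p l = 0) (l : Fin n) : ∃ m ≠ l, p m = 0 := by
  have hderiv := h.2 l
  simp only [chartPoly, map_sub, Derivation.leibniz, smul_eq_mul, map_add, map_mul, derivation_C,
    h.eval_sumFactor_eq_zero ha hp, h.eval_inverseFactor_eq_zero ha hp, zero_mul,
    mul_zero, add_zero, zero_sub, neg_eq_zero, mul_eq_zero, hs, false_or,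
    pderiv_prod_X (Finset.mem_univ l), map_prod, eval_X, eval_C] at hderiv
  obtain ⟨m, hm, hpm⟩ := Finset.prod_eq_zero_iff.1 hderiv
  exact ⟨m, Finset.ne_of_mem_erase hm, hpm⟩

end

variable {K : Type*} [Field K]

theorem sumFactor_four :
    sumFactor 4 K = 1 + X 3 + X 2 * X 3 + X 1 * X 2 * X 3 + X 0 * X 1 * X 2 * X 3 := by
  simp [sumFactor, segmentProd, Fin.sum_univ_five, Finset.prod_filter, Fin.prod_univ_four]
  ring

theorem inverseFactor_four (a : Fin 5 → K) :
    inverseFactor a = C (a 0) + C (a 1) * X 0 + C (a 2) * (X 0 * X 1) +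
      C (a 3) * (X 0 * X 1 * X 2) + C (a 4) * (X 0 * X 1 * X 2 * X 3) := by
  simp [inverseFactor, segmentProd, Fin.sum_univ_five, Finset.prod_filter, Fin.prod_univ_four]

/-- The coordinates of the node of `(∑ X_k) (∑ a_k / X_k) = s` on the toric boundary in the chart
of the identity. It is the point of the orbit `x_1 = x_2 = 0` where both factors vanish. -/
def boundaryCoords (a : Fin 5 → K) : Fin 4 → K :=
  ![-(a 0 / a 1), 0, 0, -1]

variable {a : Fin 5 → K} {s : K}

theorem IsSingularZero.eq_boundaryCoords {p : Fin 4 → K} (h : IsSingularZero (chartPoly a s) p)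
    (ha0 : a 0 ≠ 0) (ha1 : a 1 ≠ 0) (hs : s ≠ 0) (hp : ∏ l, p l = 0) : p = boundaryCoords a := by
  have hA := h.eval_sumFactor_eq_zero ha0 hp
  have hB := h.eval_inverseFactor_eq_zero ha0 hp
  simp only [sumFactor_four, inverseFactor_four, map_add, map_mul, eval_X, eval_C, map_one] at hA hB
  have hp0 : p 0 ≠ 0 := fun h0 => ha0 (by simpa [h0] using hB)
  have hp3 : p 3 ≠ 0 := fun h3 => by simp [h3] at hA
  have hp1 : p 1 = 0 := by
    obtain ⟨m, hm, hpm⟩ := h.exists_ne_eq_zero ha0 hs hp 2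
    fin_cases m
    exacts [absurd hpm hp0, hpm, absurd rfl hm, absurd hpm hp3]
  have hp2 : p 2 = 0 := by
    obtain ⟨m, hm, hpm⟩ := h.exists_ne_eq_zero ha0 hs hp 1
    fin_cases m
    exacts [absurd hpm hp0, absurd rfl hm, hpm, absurd hpm hp3]
  simp only [hp1, hp2, mul_zero, zero_mul, add_zero] at hA hB
  have hp0' : p 0 = -(a 0 / a 1) := by
    field_simp
    linear_combination hB
  ext l
  fin_cases l
  · exact hp0'
  · exact hp1
  · exact hp2
  · exact (neg_eq_of_add_eq_zero_right hA).symm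

theorem eval_boundaryCoords_sumFactor : eval (boundaryCoords a) (sumFactor 4 K) = 0 := by
  simp [sumFactor_four, boundaryCoords]

theorem eval_boundaryCoords_inverseFactor (ha1 : a 1 ≠ 0) :
    eval (boundaryCoords a) (inverseFactor a) = 0 := by
  simp [inverseFactor_four, boundaryCoords]
  field_simp
  simp

theorem hessian_chartPoly_boundaryCoords (ha1 : a 1 ≠ 0) (s : K) :
    hessian (chartPoly a s) (boundaryCoords a) =
      let x := -(a 0 / a 1)
      !![0, 0, -a 1, a 1;
        0, 0, (s - a 2) * x, a 2 * x;
        -a 1, (s - a 2) * x, 0, 0;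
        a 1, a 2 * x, 0, 0] := by
  ext i j
  rw [chartPoly, hessian_mul_sub_of_eval_eq_zero eval_boundaryCoords_sumFactor
    (eval_boundaryCoords_inverseFactor ha1), sumFactor_four, inverseFactor_four]
  fin_cases i <;> fin_cases j <;>
  simp [boundaryCoords, hessian, Fin.prod_univ_four, Derivation.leibniz, pderiv_X, Pi.single_apply]
  <;> ring

theorem det_hessian_chartPoly_boundaryCoords (ha1 : a 1 ≠ 0) (s : K) :
    (hessian (chartPoly a s) (boundaryCoords a)).det = (s * a 0) ^ 2 := by
  rw [hessian_chartPoly_boundaryCoords ha1]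
  simp [Matrix.det_succ_row_zero, Fin.sum_univ_succ, Fin.succAbove]
  field_simp
  ring

theorem isAffineNode_boundaryCoords (ha0 : a 0 ≠ 0) (ha1 : a 1 ≠ 0) (hs : s ≠ 0) :
    IsAffineNode (Ideal.span {chartPoly a s}) (boundaryCoords a) := by
  refine ⟨_, rfl, ?_, fun i => ?_, ?_⟩
  · rw [eval_chartPoly, eval_boundaryCoords_sumFactor]
    simp [boundaryCoords, Fin.prod_univ_four]
  · simp only [chartPoly, map_sub, Derivation.leibniz, smul_eq_mul, map_add, map_mul,
      eval_boundaryCoords_sumFactor, eval_boundaryCoords_inverseFactor ha1]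
    fin_cases i <;> simp [boundaryCoords, Fin.prod_univ_four, Derivation.leibniz, pderiv_X]
  · exact (det_hessian_chartPoly_boundaryCoords ha1 s).trans_ne (pow_ne_zero 2 (mul_ne_zero hs ha0))

theorem isAffineNode_iff_eq_boundaryCoords {p : Fin 4 → K} (ha0 : a 0 ≠ 0) (ha1 : a 1 ≠ 0)
    (hs : s ≠ 0) (hp : ∏ l, p l = 0) :
    IsAffineNode (Ideal.span {chartPoly a s}) p ↔ p = boundaryCoords a := by
  refine ⟨fun h => h.isSingularZero.eq_boundaryCoords ha0 ha1 hs hp, ?_⟩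
  rintro rfl
  exact isAffineNode_boundaryCoords ha0 ha1 hs

end BoundaryNodes

section Nodes

variable {K : Type*} [Field K]

theorem chartPoint_injective (ς : Equiv.Perm (Fin 5)) :
    Function.Injective (chartPoint ς : (Fin 4 → K) → ToricVariety K) := fun p q h =>
  funext fun l => Option.some_inj.1 <| by
    rw [← ratio_chartPoint_succ ς p, h, ratio_chartPoint_succ]

/-- The only node of `X_a` on the boundary of the chart of `ς`, where `a` lists the coefficients
of the `1 / X_i`. -/
def boundaryNode (a : Fin 5 → K) (ς : Equiv.Perm (Fin 5)) : ToricVariety K :=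
  chartPoint ς (boundaryCoords (a ∘ ς))

variable {a : Fin 6 → K} (ha : ∀ i, a i ≠ 0)

include ha

theorem nodes_diff_torus : nodes a \ torus K = Set.range (boundaryNode (Fin.init a)) := by
  have node_iff (ς : Equiv.Perm (Fin 5)) {p : Fin 4 → K} (hp : ∏ l, p l = 0) :
      IsAffineNode (chartIdeal a ς) p ↔ p = boundaryCoords (Fin.init a ∘ ς) := by
    rw [chartIdeal_eq_span (ha _)]
    exact isAffineNode_iff_eq_boundaryCoords (ha _) (ha _) (ha _) hp
  ext P
  constructor
  · rintro ⟨⟨ς, p, rfl, node⟩, boundary⟩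
    rw [chartPoint_mem_torus_iff, not_forall_not] at boundary
    obtain ⟨l, hl⟩ := boundary
    have prod_eq_zero : ∏ l, p l = 0 := Finset.prod_eq_zero (Finset.mem_univ l) hl
    exact ⟨ς, congrArg (chartPoint ς) ((node_iff ς prod_eq_zero).1 node).symm⟩
  · rintro ⟨ς, rfl⟩
    have vanishing : boundaryCoords (Fin.init a ∘ ς) 1 = 0 := rfl
    refine ⟨⟨ς, _, rfl, (node_iff ς ?_).2 rfl⟩, fun h => ?_⟩
    · exact Finset.prod_eq_zero (Finset.mem_univ 1) vanishing
    · exact (chartPoint_mem_torus_iff ς _).1 h 1 vanishing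

theorem torusPoint_mem_nodes_iff (h2 : (2 : K) ≠ 0) {c : Fin 5 → K} (hc : ∀ i, c i ≠ 0) :
    torusPoint c ∈ nodes a ↔
      ∑ i, c i ≠ 0 ∧ ∀ i, a (Fin.last 5) * c i ^ 2 = (∑ i, c i) ^ 2 * a i.castSucc := by
  have node_iff (ς : Equiv.Perm (Fin 5)) :
      IsAffineNode (chartIdeal a ς) (torusCoords (c ∘ ς)) ↔
        ∑ i, c i ≠ 0 ∧ ∀ i, a (Fin.last 5) * c i ^ 2 = (∑ i, c i) ^ 2 * a i.castSucc := by
    rw [chartIdeal_eq_span (ha _),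
      isAffineNode_chartPoly_torusCoords_iff (c := c ∘ ς) (fun _ => hc _) h2 (ha _)]
    simp only [Function.comp_apply, Equiv.sum_comp ς c]
    exact and_congr_right fun _ => ς.forall_congr_right
      (q := fun i => a (Fin.last 5) * c i ^ 2 = (∑ i, c i) ^ 2 * a i.castSucc)
  constructor
  · rintro ⟨ς, p, h, node⟩
    rw [torusPoint_eq_chartPoint ς hc] at h
    rw [← chartPoint_injective ς h] at node
    exact (node_iff ς).1 node
  · intro h
    exact ⟨1, _, torusPoint_eq_chartPoint 1 hc, (node_iff 1).2 h⟩

end Nodes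

section Count

/-- The position of an index in the ordered partition `{0, 1}, {2}, {3, 4}`. -/
def block : Fin 5 → Fin 3 := ![0, 0, 1, 2, 2]

theorem sum_block_eq {M : Type*} [AddCommMonoid M] (f : Fin 5 → M) (ς : Equiv.Perm (Fin 5))
    (r : Fin 3) :
    ∑ i with block (ς.symm i) = r, f i = ∑ k with block k = r, f (ς k) := by
  simp only [Finset.sum_filter, ← Equiv.sum_comp ς (fun i => ite _ (f i) 0), Equiv.symm_apply_apply]

theorem leadingSet_eq_of_block_eq {ς τ : Equiv.Perm (Fin 5)}
    (h : block ∘ ς.symm = block ∘ τ.symm) {l : Fin 4} (hl : l ∈ ({1, 2} : Finset (Fin 4))) :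
    leadingSet ς l = leadingSet τ l := by
  have block_iff : ∀ l ∈ ({1, 2} : Finset (Fin 4)), ∀ k : Fin 5,
      k ≤ l.castSucc ↔ block k < block l.succ := by
    unfold block
    decide
  ext i
  rw [mem_leadingSet, mem_leadingSet, block_iff l hl, block_iff l hl]
  exact iff_of_eq (congrArg (· < _) (congrFun h i))

variable {K : Type*} [Field K] {a : Fin 5 → K} (ha : ∀ i, a i ≠ 0)

include ha

theorem ratio_boundaryNode_eq_zero_iff (ς : Equiv.Perm (Fin 5)) (i j : Fin 5) :
    ratio (boundaryNode a ς) i j = some 0 ↔ block (ς.symm i) < block (ς.symm j) := by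
  have vanishing (l : Fin 4) : boundaryCoords (a ∘ ς) l = 0 ↔ l = 1 ∨ l = 2 := by
    fin_cases l <;> simp [boundaryCoords, ha]
  have block_lt_iff : ∀ k l : Fin 5, block k < block l ↔
      k ≤ l ∧ ∃ m : Fin 4, (k ≤ m.castSucc ∧ m.castSucc < l) ∧ (m = 1 ∨ m = 2) := by
    unfold block
    decide
  simp only [boundaryNode, ratio_chartPoint_eq_zero_iff, segmentProd, Finset.prod_eq_zero_iff,
    Finset.mem_filter_univ, vanishing, block_lt_iff]

theorem piecewise_torusCoords_eq_boundaryCoords {c : Fin 5 → K} (hc : ∀ i, c i ≠ 0)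
    {ς : Equiv.Perm (Fin 5)} (first : ∑ i with block (ς.symm i) = 0, c i / a i = 0)
    (last : ∑ i with block (ς.symm i) = 2, c i = 0) :
    ({1, 2} : Finset (Fin 4)).piecewise 0 (torusCoords (c ∘ ς)) = boundaryCoords (a ∘ ς) := by
  have block_zero : ({k | block k = 0} : Finset (Fin 5)) = {0, 1} := by decide
  have block_two : ({k | block k = 2} : Finset (Fin 5)) = {3, 4} := by decide
  rw [sum_block_eq, block_zero, Finset.sum_pair (by decide)] at first
  rw [sum_block_eq, block_two, Finset.sum_pair (by decide)] at last
  have ratio_first : c (ς 0) / c (ς 1) = -(a (ς 0) / a (ς 1)) := by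
    have := ha (ς 0)
    have := ha (ς 1)
    have := hc (ς 1)
    field_simp at first ⊢
    linear_combination first
  have ratio_last : c (ς 3) / c (ς 4) = -1 := by
    rw [eq_neg_of_add_eq_zero_left last, neg_div, div_self (hc _)]
  funext l
  fin_cases l
  exacts [ratio_first, rfl, rfl, ratio_last]

theorem boundaryNode_eq_of_block_eq {ς τ : Equiv.Perm (Fin 5)}
    (h : block ∘ ς.symm = block ∘ τ.symm) : boundaryNode a ς = boundaryNode a τ := by
  let c : Fin 5 → K := ![a (ς 0), -a (ς 1), 1, 1, -1] ∘ ς.symm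
  have hc (i) : c i ≠ 0 := by
    generalize hk : ς.symm i = k
    simp only [c, Function.comp_apply, hk]
    fin_cases k <;> simp [ha]
  have first : ∑ i with block (ς.symm i) = 0, c i / a i = 0 := by
    rw [sum_block_eq, Finset.sum_filter]
    simp [Fin.sum_univ_five, block, c, ha]
  have last : ∑ i with block (ς.symm i) = 2, c i = 0 := by
    rw [sum_block_eq, Finset.sum_filter]
    simp [Fin.sum_univ_five, block, c]
  have block_eq (i) : block (ς.symm i) = block (τ.symm i) := congrFun h i
  rw [boundaryNode, boundaryNode, ← piecewise_torusCoords_eq_boundaryCoords ha hc first last,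
    chartPoint_piecewise_eq (fun l => leadingSet_eq_of_block_eq h) hc]
  simp only [block_eq] at first last
  rw [piecewise_torusCoords_eq_boundaryCoords ha hc first last]

theorem boundaryNode_eq_iff (ς τ : Equiv.Perm (Fin 5)) :
    boundaryNode a ς = boundaryNode a τ ↔ block ∘ ς.symm = block ∘ τ.symm := by
  have block_surjective : Function.Surjective block := by
    unfold block
    decide
  refine ⟨fun h => ?_, boundaryNode_eq_of_block_eq ha⟩
  refine eq_of_lt_iff_lt (block_surjective.comp ς.symm.surjective)
    (block_surjective.comp τ.symm.surjective) fun i j => ?_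
  rw [Function.comp_apply, Function.comp_apply, ← ratio_boundaryNode_eq_zero_iff ha, h,
    ratio_boundaryNode_eq_zero_iff ha]
  rfl

theorem encard_range_boundaryNode : (Set.range (boundaryNode a)).encard = 30 := by
  have card_blocks :
      (Finset.univ.image fun ς : Equiv.Perm (Fin 5) => block ∘ ς.symm).card = 30 := by
    decide +kernel
  rw [encard_range_eq_of_eq_iff_eq (boundaryNode_eq_iff ha), ← Set.image_univ, ← Finset.coe_univ,
    ← Finset.coe_image, Set.encard_coe_eq_coe_finsetCard, card_blocks]
  rfl

end Count

section SignChanges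

variable {K : Type*} [Field K]

theorem signChange_sq (b : Fin 5 → K) (J : Finset (Fin 5)) (i : Fin 5) :
    signChange b J i ^ 2 = b i ^ 2 := by
  unfold signChange
  split_ifs
  exacts [neg_sq _, rfl]

theorem sum_signChange (b : Fin 5 → K) (J : Finset (Fin 5)) :
    ∑ i, signChange b J i = ∑ i, b i - 2 * ∑ i ∈ J, b i := by
  have indicator : ∑ i ∈ J, b i = ∑ i, if i ∈ J then b i else 0 := by simp
  rw [indicator, Finset.mul_sum, ← Finset.sum_sub_distrib]
  refine Finset.sum_congr rfl fun i _ => ?_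
  unfold signChange
  split_ifs <;> ring

theorem exists_eq_signChange {b c : Fin 5 → K} (hc : ∀ i, c i ^ 2 = b i ^ 2) :
    ∃ J, signChange b J = c := by
  classical
  refine ⟨Finset.univ.filter fun i => c i = -b i, funext fun i => ?_⟩
  simp only [signChange, Finset.mem_filter_univ]
  split_ifs with h
  exacts [h.symm, ((sq_eq_sq_iff_eq_or_eq_neg.1 (hc i)).resolve_right h).symm]

theorem signChange_ne_zero {b : Fin 5 → K} (hb : ∀ i, b i ≠ 0) (J : Finset (Fin 5)) (i : Fin 5) :
    signChange b J i ≠ 0 := by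
  rw [← sq_eq_zero_iff.ne, signChange_sq]
  exact pow_ne_zero 2 (hb i)

theorem signChange_injective (h2 : (2 : K) ≠ 0) {b : Fin 5 → K} (hb : ∀ i, b i ≠ 0) :
    Function.Injective (signChange b) := by
  have neg_ne (i) : -b i ≠ b i := fun h =>
    mul_ne_zero h2 (hb i) (by linear_combination -h)
  have mem_iff (J : Finset (Fin 5)) (i) : i ∈ J ↔ signChange b J i = -b i := by
    simp [signChange, (neg_ne i).symm]
  intro J J' h
  ext i
  rw [mem_iff, mem_iff, h]

theorem eq_of_torusPoint_eq {c d : Fin 5 → K} (hc : ∀ i, c i ≠ 0) (hd : ∀ i, d i ≠ 0)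
    (sum_eq : ∑ i, c i = ∑ i, d i) (sum_ne : ∑ i, d i ≠ 0) (h : torusPoint c = torusPoint d) :
    c = d := by
  have cross (i j : Fin 5) : d i * c j = c i * d j := by
    have ratio_eq := ratio_torusPoint hc i j
    rw [h, ratio_torusPoint hd, Option.some_inj, div_eq_div_iff (hd j) (hc j)] at ratio_eq
    exact ratio_eq
  funext i
  apply mul_right_cancel₀ sum_ne
  rw [Finset.mul_sum, ← Finset.sum_congr rfl fun j _ => cross i j, ← Finset.mul_sum, sum_eq]

end SignChanges

section TorusNodes

variable {K : Type*} [Field K] {b : Fin 5 → K} (hb : ∀ i, b i ≠ 0) (hs : ∑ i, b i ≠ 0)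

include hb hs

theorem phi_ne_zero (i : Fin 6) : phi b i ≠ 0 := by
  refine Fin.lastCases ?_ (fun i => ?_) i
  · simpa only [phi, Fin.snoc_last] using pow_ne_zero 2 hs
  · simpa only [phi, Fin.snoc_castSucc] using pow_ne_zero 2 (hb i)

variable (h2 : (2 : K) ≠ 0)

include h2

theorem torusPoint_mem_nodes_phi_iff {c : Fin 5 → K} (hc : ∀ i, c i ≠ 0) :
    torusPoint c ∈ nodes (phi b) ↔
      ∑ i, c i ≠ 0 ∧ ∀ i, ((∑ i, b i) * c i) ^ 2 = ((∑ i, c i) * b i) ^ 2 := by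
  rw [torusPoint_mem_nodes_iff (phi_ne_zero hb hs) h2 hc]
  simp only [phi, Fin.snoc_last, Fin.snoc_castSucc, mul_pow]

theorem exists_torusPoint_signChange_eq {c : Fin 5 → K} (hc : ∀ i, c i ≠ 0)
    (node : torusPoint c ∈ nodes (phi b)) :
    ∃ J, ∑ i ∈ J, b i = 0 ∧ torusPoint (signChange b J) = torusPoint c := by
  obtain ⟨sum_ne, sq_eq⟩ := (torusPoint_mem_nodes_phi_iff hb hs h2 hc).1 node
  have rescale_ne : (∑ i, b i) / ∑ i, c i ≠ 0 := div_ne_zero hs sum_ne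
  obtain ⟨J, hJ⟩ := exists_eq_signChange (b := b) (c := ((∑ i, b i) / ∑ i, c i) • c) fun i => by
    rw [Pi.smul_apply, smul_eq_mul, div_mul_eq_mul_div, div_pow, sq_eq, mul_pow,
      mul_div_cancel_left₀ _ (pow_ne_zero 2 sum_ne)]
  refine ⟨J, ?_, ?_⟩
  · have sum_eq := sum_signChange b J
    simp only [hJ, Pi.smul_apply, smul_eq_mul, ← Finset.mul_sum, div_mul_cancel₀ _ sum_ne] at sum_eq
    exact (mul_eq_zero.1 (sub_eq_self.1 sum_eq.symm)).resolve_left h2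
  · rw [hJ]
    exact congrArg (chartPoint 1) (torusCoords_smul rescale_ne c)

theorem bijOn_torusPoint_signChange :
    Set.BijOn (fun J : Finset (Fin 5) => torusPoint (signChange b J))
      {J : Finset (Fin 5) | ∑ i ∈ J, b i = 0} (nodes (phi b) ∩ torus K) := by
  have sum_eq {J : Finset (Fin 5)} (hJ : ∑ i ∈ J, b i = 0) :
      ∑ i, signChange b J i = ∑ i, b i := by
    rw [sum_signChange, hJ, mul_zero, sub_zero]
  refine ⟨fun J hJ => ⟨?_, _, signChange_ne_zero hb J, rfl⟩, fun J hJ J' hJ' h => ?_, ?_⟩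
  · rw [torusPoint_mem_nodes_phi_iff hb hs h2 (signChange_ne_zero hb J), sum_eq hJ]
    exact ⟨hs, fun i => by rw [mul_pow, signChange_sq, mul_pow]⟩
  · refine signChange_injective h2 hb (eq_of_torusPoint_eq (signChange_ne_zero hb J)
      (signChange_ne_zero hb J') ((sum_eq hJ).trans (sum_eq hJ').symm) ?_ h)
    rwa [sum_eq hJ']
  · rintro _ ⟨node, c, hc, rfl⟩
    exact exists_torusPoint_signChange_eq hb hs h2 hc node

end TorusNodes

end A4Toric

end

theorem mainTheorem9 {K : Type*} [Field K] (h2 : (2 : K) ≠ 0) (b : Fin 5 → K)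
    (hb : ∀ i, b i ≠ 0) (hs : ∑ i, b i ≠ 0) :
    (A4Toric.nodes (A4Toric.phi b)).encard =
        30 + {J : Finset (Fin 5) | ∑ i ∈ J, b i = 0}.encard ∧
      (A4Toric.nodes (A4Toric.phi b) \ A4Toric.torus K).encard = 30 ∧
      Set.BijOn (fun J : Finset (Fin 5) => A4Toric.torusPoint (A4Toric.signChange b J))
        {J : Finset (Fin 5) | ∑ i ∈ J, b i = 0}
        (A4Toric.nodes (A4Toric.phi b) ∩ A4Toric.torus K) := by
  have torusNodes := A4Toric.bijOn_torusPoint_signChange hb hs h2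
  have boundaryNodes : (A4Toric.nodes (A4Toric.phi b) \ A4Toric.torus K).encard = 30 := by
    have phi_ne_zero := A4Toric.phi_ne_zero hb hs
    rw [A4Toric.nodes_diff_torus phi_ne_zero]
    exact A4Toric.encard_range_boundaryNode fun i => phi_ne_zero i.castSucc
  refine ⟨?_, boundaryNodes, torusNodes⟩
  rw [← Set.encard_sdiff_add_encard_inter (A4Toric.nodes (A4Toric.phi b)) (A4Toric.torus K),
    boundaryNodes, ← torusNodes.image_eq, torusNodes.injOn.encard_image]
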